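/- **Theorem 5.2 (Convergence of space approximations).** Let $Y$ be a separable reflexive real Banach space with norm $|\cdot|$, dual $Y^*$ and duality pairing $\langle\cdot,\cdot\rangle$, and let $T>0$. Let $\psi:Y\to[0,\infty]$ be proper, convex, lower semicontinuous and positively $1$-homogeneous, let $A:Y\to Y^*$ be linear, continuous and symmetric, and put $\phi(y)=\tfrac12\langle Ay,y\rangle$ and $\chi(y)=\phi(y)+|y|^2$; assume that $\chi(y)>0$ for all $y\neq 0$. For $f:Y\to(-\infty,\infty]$ write $D(f)=\{f<\infty\}$ and $f^*(y^*)=\sup_{y\in Y}(\langle y^*,y\rangle-f(y))$. For $\ell:[0,T]\to Y^*$, $y_0\in Y$ and $y\in W^{1,1}(0,T;Y)$ let $$F(y)=\int_0^T\Big(\psi(y')+\psi^*(\ell-Ay)-\langle \ell-Ay,y'\rangle\Big)\,dt+\chi(y(0)-y_0).$$ For every $h>0$ let $Y_h\subset Y$ be a closed subspace, $\psi_h:Y\to(-\infty,\infty]$ a convex, proper, lower semicontinuous and positively $1$-homogeneous functional, $\ell_h:[0,T]\to Y^*$ and $y_{0,h}\in Y_h$. Let $\phi_h=\phi$ on $Y_h$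 and $\phi_h=\infty$ on $Y\setminus Y_h$, let $\chi_h=\phi_h+|\cdot|^2$, and let $A_h$ be the operator with domain $Y_h$ given by $A_hy=Ay$ for $y\in Y_h$. For $y\in W^{1,1}(0,T;Y)$ let $$F_h(y)=\int_0^T\Big(\psi_h(y')+\psi_h^*(\ell_h-A_hy)-\langle \ell_h-A_hy,y'\rangle\Big)\,dt+\chi_h(y(0)-y_{0,h}),$$ where the integrand is $\infty$ at times at which $y\notin Y_h$. Assume that - $\bigcup_{h>0}Y_h$ is dense in $Y$; - $\psi_h\to\psi$ as $h\to0$ in the Mosco sense in $Y$, that is, for every sequence $h_n>0$ with $h_n\to0$ and every $y\in Y$: $\psi(y)\le\liminf_n\psi_{h_n}(y_n)$ whenever $y_n\to y$ weakly in $Y$, and there are $y_n\to y$ strongly in $Y$ with $\psi(y)=\limsup_n\psi_{h_n}(y_n)$; - there is $\alpha>0$, independent of $h$, with $\phi(y)\ge\frac\alpha2|y|^2$ for all $h>0$ and all $y\in D(\psi_h)-D(\psi_h)$; - $\ell_h(t)\to\ell(t)$ strongly in $Y^*$ as $h\to 0$ for all $t\in[0,T]$, and the functions $\ell_h$ are Lipschitz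 continuous on $[0,T]$ with a constant independent of $h$; - $y_{0,h}\to y_0$ strongly in $Y$ as $h\to0$. Let $y_h\in W^{1,1}(0,T;Y)$ satisfy $F_h(y_h)=0$ for every $h>0$. Then $y_h\in W^{1,\infty}(0,T;Y)$ for every $h>0$, and there is $y\in W^{1,\infty}(0,T;Y)$ such that $F(y)=0$ and $y_h\to y$ weakly star in $W^{1,\infty}(0,T;Y)$ as $h\to0$, that is, $\int_0^T\langle w,y_h\rangle\,dt\to\int_0^T\langle w,y\rangle\,dt$ and $\int_0^T\langle w,y_h'\rangle\,dt\to\int_0^T\langle w,y'\rangle\,dt$ for all $w\in L^1(0,T;Y^*)$. Moreover $y$ is the only element of $W^{1,1}(0,T;Y)$ with $F(y)=0$. -/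

import Mathlib

open Filter Topology MeasureTheory Set
open scoped Pointwise ENNReal NNReal

namespace HardeningPlasticity

noncomputable section

variable {Y : Type*} [NormedAddCommGroup Y] [NormedSpace ℝ Y]

/-! ### Convex functions with values in `(-∞, ∞]` -/

/-- The effective domain `D(f)`. -/
def dom {X : Type*} (f : X → EReal) : Set X := {x | f x < ⊤}

/-- `f : Y → (-∞, ∞]` is proper: it avoids `-∞` and is not identically `∞`. -/
def IsProper (f : Y → EReal) : Prop := (∀ x, f x ≠ ⊥) ∧ ∃ x, f x ≠ ⊤

/-- Convexity of a function that avoids `-∞`. -/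
def IsConvexFun (f : Y → EReal) : Prop :=
  ∀ x y : Y, ∀ a b : ℝ, 0 < a → 0 < b → a + b = 1 →
    f (a • x + b • y) ≤ (a : EReal) * f x + (b : EReal) * f y

/-- Positive `1`-homogeneity. -/
def IsPosHomogeneous (f : Y → EReal) : Prop :=
  ∀ x : Y, ∀ c : ℝ, 0 < c → f (c • x) = (c : EReal) * f x

/-- `f` is convex, proper, lower semicontinuous and positively `1`-homogeneous. -/
structure IsDissipation (f : Y → EReal) : Prop where
  proper : IsProper f
  convex : IsConvexFun f
  lsc : LowerSemicontinuous f
  homogeneous : IsPosHomogeneous f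

/-- The convex conjugate `f^*(ξ) = sup_y (⟨ξ, y⟩ - f y)`. -/
def conj (f : Y → EReal) (ξ : StrongDual ℝ Y) : EReal := ⨆ y : Y, ((ξ y : ℝ) : EReal) - f y

/-- Weak convergence of a sequence in `Y`. -/
def WeakTendsto (u : ℕ → Y) (y : Y) : Prop :=
  ∀ ξ : StrongDual ℝ Y, Tendsto (fun n => ξ (u n)) atTop (𝓝 (ξ y))

/-- Mosco convergence of a sequence of functions on `Y`. -/
def MoscoTendsto (f : ℕ → Y → EReal) (g : Y → EReal) : Prop :=
  ∀ y : Y,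
    (∀ u : ℕ → Y, WeakTendsto u y → g y ≤ liminf (fun n => f n (u n)) atTop) ∧
    ∃ u : ℕ → Y, Tendsto u atTop (𝓝 y) ∧ g y = limsup (fun n => f n (u n)) atTop

/-! ### Vector-valued Sobolev functions on `(0, T)` -/

/-- `y ∈ W^{1,p}(0,T;Y)`, in terms of the continuous representative on `[0,T]`: `y` is a primitive
of a function in `L^p(0,T;Y)`. That function is then `deriv y` a.e. in `(0,T)`. -/
def MemW1p (T : ℝ) (p : ℝ≥0∞) (y : ℝ → Y) : Prop :=
  ∃ g : ℝ → Y, MemLp g p (volume.restrict (Ioo 0 T)) ∧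
    ∀ t ∈ Icc 0 T, y t = y 0 + ∫ s in (0 : ℝ)..t, g s

/-- Weak-star convergence `y_h → y` in `W^{1,∞}(0,T;Y)` as `h → 0+`: all functions belong to
`W^{1,∞}(0,T;Y)`, and both the functions and their derivatives converge against every
`w ∈ L^1(0,T;Y^*)`. -/
def WeakStarTendsto (T : ℝ) (yh : ℝ → ℝ → Y) (y : ℝ → Y) : Prop :=
  (∀ h, 0 < h → MemW1p T ∞ (yh h)) ∧ MemW1p T ∞ y ∧
    ∀ w : ℝ → StrongDual ℝ Y, Integrable w (volume.restrict (Ioo 0 T)) →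
      Tendsto (fun h => ∫ t in Ioo 0 T, w t (yh h t)) (𝓝[>] 0)
        (𝓝 (∫ t in Ioo 0 T, w t (y t))) ∧
      Tendsto (fun h => ∫ t in Ioo 0 T, w t (deriv (yh h) t)) (𝓝[>] 0)
        (𝓝 (∫ t in Ioo 0 T, w t (deriv y t)))

/-! ### The functional -/

/-- `φ(y) = ½ ⟨A y, y⟩`. -/
def phi (A : Y →L[ℝ] StrongDual ℝ Y) (y : Y) : ℝ := 1 / 2 * A y y

/-- `χ(y) = φ(y) + |y|²`. -/
def chi (A : Y →L[ℝ] StrongDual ℝ Y) (y : Y) : ℝ := phi A y + ‖y‖ ^ 2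

/-- The integrand `ψ(p) + ψ^*(ξ - A y) - ⟨ξ - A y, p⟩`. -/
def lagrangian (ψ : Y → EReal) (A : Y →L[ℝ] StrongDual ℝ Y) (ξ : StrongDual ℝ Y) (y p : Y) :
    EReal :=
  ψ p + conj ψ (ξ - A y) - (((ξ - A y) p : ℝ) : EReal)

/-- By Fenchel's inequality the integrand takes values in `[0, ∞]`, so that the truncation `toENNReal`
in the integrals below has no effect. -/
theorem lagrangian_nonneg {ψ : Y → EReal} (hψ : IsProper ψ) (A : Y →L[ℝ] StrongDual ℝ Y)
    (ξ : StrongDual ℝ Y) (y p : Y) : 0 ≤ lagrangian ψ A ξ y p := by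
  obtain ⟨hb, x, hx⟩ := hψ
  have hc : ∀ z, (((ξ - A y) z : ℝ) : EReal) - ψ z ≤ conj ψ (ξ - A y) := fun z =>
    le_iSup (fun z => (((ξ - A y) z : ℝ) : EReal) - ψ z) z
  have hcb : conj ψ (ξ - A y) ≠ ⊥ := by
    intro h
    have h1 := hc x
    rw [h, le_bot_iff] at h1
    lift ψ x to ℝ using ⟨hx, hb x⟩ with r
    exact absurd h1 (by rw [← EReal.coe_sub]; exact EReal.coe_ne_bot _)
  have h2 := hc p
  have h3 := hb p
  unfold lagrangian
  generalize (ξ - A y) p = a at h2 ⊢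
  generalize conj ψ (ξ - A y) = c at *
  generalize ψ p = b at *
  induction b with
  | bot => exact absurd rfl h3
  | top => rw [EReal.top_add_of_ne_bot hcb, EReal.top_sub_coe]; exact le_top
  | coe b =>
    induction c with
    | bot => exact absurd rfl hcb
    | top => rw [EReal.coe_add_top, EReal.top_sub_coe]; exact le_top
    | coe c =>
      rw [← EReal.coe_sub, EReal.coe_le_coe_iff] at h2
      rw [← EReal.coe_add, ← EReal.coe_sub, ← EReal.coe_zero, EReal.coe_le_coe_iff]
      linarith

/-- `F(y) = ∫₀ᵀ (ψ(y') + ψ^*(ℓ - A y) - ⟨ℓ - A y, y'⟩) dt + χ(y(0) - y₀)`. -/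
def F (T : ℝ) (ψ : Y → EReal) (A : Y →L[ℝ] StrongDual ℝ Y) (ℓ : ℝ → StrongDual ℝ Y) (y₀ : Y)
    (y : ℝ → Y) : EReal :=
  ((∫⁻ t in Ioo 0 T, (lagrangian ψ A (ℓ t) (y t) (deriv y t)).toENNReal : ℝ≥0∞) : EReal) +
    ((chi A (y 0 - y₀) : ℝ) : EReal)

open Classical in
/-- `φ_h = φ` on the subspace `V` and `φ_h = ∞` elsewhere. -/
def phiSub (V : Submodule ℝ Y) (A : Y →L[ℝ] StrongDual ℝ Y) (y : Y) : EReal :=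
  if y ∈ V then ((phi A y : ℝ) : EReal) else ⊤

/-- `χ_h(y) = φ_h(y) + |y|²`. -/
def chiSub (V : Submodule ℝ Y) (A : Y →L[ℝ] StrongDual ℝ Y) (y : Y) : EReal :=
  phiSub V A y + ((‖y‖ ^ 2 : ℝ) : EReal)

open Classical in
/-- The integrand `ψ_h(p) + ψ_h^*(ξ - A_h y) - ⟨ξ - A_h y, p⟩`, where the operator `A_h` has domain
`V` and `A_h y = A y` for `y ∈ V`; it is `∞` for `y` outside the domain of `A_h`. -/
def lagrangianSub (V : Submodule ℝ Y) (ψ : Y → EReal) (A : Y →L[ℝ] StrongDual ℝ Y)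
    (ξ : StrongDual ℝ Y) (y p : Y) : EReal :=
  if y ∈ V then lagrangian ψ A ξ y p else ⊤

/-- `F_h(y) = ∫₀ᵀ (ψ_h(y') + ψ_h^*(ℓ_h - A_h y) - ⟨ℓ_h - A_h y, y'⟩) dt + χ_h(y(0) - y_{0,h})`. -/
def FSub (T : ℝ) (V : Submodule ℝ Y) (ψ : Y → EReal) (A : Y →L[ℝ] StrongDual ℝ Y)
    (ℓ : ℝ → StrongDual ℝ Y) (y₀ : Y) (y : ℝ → Y) : EReal :=
  ((∫⁻ t in Ioo 0 T, (lagrangianSub V ψ A (ℓ t) (y t) (deriv y t)).toENNReal : ℝ≥0∞) : EReal) +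
    chiSub V A (y 0 - y₀)

end

end HardeningPlasticity

namespace HardeningPlasticity

noncomputable section

variable {Y : Type*} [NormedAddCommGroup Y] [NormedSpace ℝ Y]

/-! ### Sobolev functions on an interval -/

/-! The conjugate of a positively `1`-homogeneous `ψ` only takes the values `0` and `∞`, so `F y =
0` splits into three conditions: the initial condition, stability `ℓ t - A (y t) ≤ ψ` at every time,
and the flow rule `ψ(y') = ⟨ℓ - A y, y'⟩` almost everywhere. This is `IsEvolution`, and each `y_h`
satisfies it with its own data.

Two estimates come from coercivity on `dom ψ - dom ψ`. Testing stability at an earlier time with the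
present velocity bounds `|y'|` by `K / α` (`IsEvolution.norm_deriv_le`). Testing two evolutions with
each other's velocities shows that `φ` of their difference does not increase, which gives uniqueness
(`IsEvolution.eqOn`); there Jensen's inequality places the increments in `dom ψ`.

The Lipschitz bound is uniform in `h`. Since the dual of a separable reflexive space is separable,
every sequence of parameters has a subsequence along which `y_h(t)` converges weakly at all `t` and
the work done up to time `t` converges to some `E(t)`. Stability is affine in the state, so it
passes to the limit along strongly convergent recovery sequences. The weak liminf inequality gives
`ψ(y t - y s) ≤ E t - E s`; combined with stability of the limit, this makes `E` grow at least as
fast as the work of the limit. If moreover `E T` is at most the total work of the limit, the two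
functions coincide, and differentiating the increment bound yields the flow rule
(`isEvolution_of_dissipation_le`).

The crux is this final bound on `E T`. It needs lower semicontinuity of `φ` along `y_h(T)`, but `φ`
is controlled only on differences of elements of `dom ψ_h`. Subtracting from `y_h(T) - y_h(0)` a
recovery sequence for the limit increment gives such a difference, and expanding the square there
suffices (`MoscoTendsto.isEvolution`). Uniqueness of the limit then upgrades subsequences to the
whole family. -/

theorem uIoc_subset_Ioc {T s t : ℝ} (hs : s ∈ Icc 0 T) (ht : t ∈ Icc 0 T) :
    uIoc s t ⊆ Ioc 0 T := by
  intro x hx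
  rw [mem_uIoc] at hx
  rcases hx with hx | hx
  · exact ⟨hs.1.trans_lt hx.1, hx.2.trans ht.2⟩
  · exact ⟨ht.1.trans_lt hx.1, hx.2.trans hs.2⟩

theorem ae_restrict_uIoc {T s t : ℝ} (hs : s ∈ Icc 0 T) (ht : t ∈ Icc 0 T) {P : ℝ → Prop}
    (h : ∀ᵐ x ∂volume.restrict (Ioo 0 T), P x) : ∀ᵐ x ∂volume.restrict (uIoc s t), P x := by
  rw [restrict_Ioo_eq_restrict_Ioc] at h
  exact ae_restrict_of_ae_restrict_of_subset (uIoc_subset_Ioc hs ht) h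

theorem intervalIntegrable_of_Ioo {E : Type*} [NormedAddCommGroup E] {T s t : ℝ} {f : ℝ → E}
    (hs : s ∈ Icc 0 T) (ht : t ∈ Icc 0 T) (h : Integrable f (volume.restrict (Ioo 0 T))) :
    IntervalIntegrable f volume s t := by
  rw [intervalIntegrable_iff]
  rw [restrict_Ioo_eq_restrict_Ioc] at h
  exact IntegrableOn.mono_set h (uIoc_subset_Ioc hs ht)

theorem intervalIntegral_eq_Ioo {E : Type*} [NormedAddCommGroup E] [NormedSpace ℝ E] {T : ℝ}
    (hT : 0 ≤ T) (f : ℝ → E) : ∫ t in (0 : ℝ)..T, f t = ∫ t in Ioo 0 T, f t := by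
  rw [intervalIntegral.integral_of_le hT, restrict_Ioo_eq_restrict_Ioc]

theorem intervalIntegral_congr_Ioo {E : Type*} [NormedAddCommGroup E] [NormedSpace ℝ E]
    {T s t : ℝ} {f g : ℝ → E} (hs : s ∈ Icc 0 T) (ht : t ∈ Icc 0 T)
    (h : ∀ᵐ x ∂volume.restrict (Ioo 0 T), f x = g x) :
    ∫ x in s..t, f x = ∫ x in s..t, g x :=
  intervalIntegral.integral_congr_ae ((ae_restrict_iff' measurableSet_uIoc).1
    (ae_restrict_uIoc hs ht h))

/-- A primitive is differentiable almost everywhere. -/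
theorem ae_hasDerivAt_of_eq_add_integral [CompleteSpace Y] {T : ℝ} (hT : 0 < T) {y g : ℝ → Y}
    (hg : Integrable g (volume.restrict (Ioo 0 T)))
    (hy : ∀ t ∈ Icc 0 T, y t = y 0 + ∫ s in (0 : ℝ)..t, g s) :
    ∀ᵐ t ∂volume.restrict (Ioo 0 T), HasDerivAt y (g t) t := by
  have h0 : (0 : ℝ) ∈ Icc 0 T := ⟨le_rfl, hT.le⟩
  have h1 : T ∈ Icc 0 T := ⟨hT.le, le_rfl⟩
  have hi := intervalIntegrable_of_Ioo h0 h1 hg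
  rw [ae_restrict_iff' measurableSet_Ioo]
  filter_upwards [hi.ae_hasDerivAt_integral] with t ht hmem
  rw [uIcc_of_le hT.le] at ht
  have h2 := (ht (Ioo_subset_Icc_self hmem) 0 h0).const_add (y 0)
  refine h2.congr_of_eventuallyEq ?_
  filter_upwards [Ioo_mem_nhds hmem.1 hmem.2] with s hs
  exact hy s (Ioo_subset_Icc_self hs)

theorem MemW1p.exists_ae_hasDerivAt [CompleteSpace Y] {T : ℝ} (hT : 0 < T) {p : ℝ≥0∞}
    (hp : 1 ≤ p) {y : ℝ → Y} (h : MemW1p T p y) :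
    ∃ g : ℝ → Y, MemLp g p (volume.restrict (Ioo 0 T)) ∧
      (∀ t ∈ Icc 0 T, y t = y 0 + ∫ s in (0 : ℝ)..t, g s) ∧
      ∀ᵐ t ∂volume.restrict (Ioo 0 T), HasDerivAt y (g t) t := by
  obtain ⟨g, hg, hy⟩ := h
  exact ⟨g, hg, hy, ae_hasDerivAt_of_eq_add_integral hT (hg.integrable hp) hy⟩

theorem MemW1p.ae_hasDerivAt [CompleteSpace Y] {T : ℝ} (hT : 0 < T)
    {y : ℝ → Y} (h : MemW1p T 1 y) :
    ∀ᵐ t ∂volume.restrict (Ioo 0 T), HasDerivAt y (deriv y t) t := by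
  obtain ⟨g, -, -, h⟩ := h.exists_ae_hasDerivAt hT le_rfl
  filter_upwards [h] with t ht
  rwa [ht.deriv]

theorem MemW1p.memLp_deriv [CompleteSpace Y] {T : ℝ} (hT : 0 < T) {p : ℝ≥0∞}
    (hp : 1 ≤ p) {y : ℝ → Y} (h : MemW1p T p y) :
    MemLp (deriv y) p (volume.restrict (Ioo 0 T)) := by
  obtain ⟨g, hg, -, h⟩ := h.exists_ae_hasDerivAt hT hp
  refine (memLp_congr_ae ?_).1 hg
  filter_upwards [h] with t ht
  exact ht.deriv.symm

theorem MemW1p.integrable_deriv [CompleteSpace Y] {T : ℝ} (hT : 0 < T)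
    {y : ℝ → Y} (h : MemW1p T 1 y) : Integrable (deriv y) (volume.restrict (Ioo 0 T)) :=
  memLp_one_iff_integrable.1 (h.memLp_deriv hT le_rfl)

theorem MemW1p.sub_eq_integral [CompleteSpace Y] {T : ℝ} (hT : 0 < T)
    {y : ℝ → Y} (h : MemW1p T 1 y) {s t : ℝ} (hs : s ∈ Icc 0 T) (ht : t ∈ Icc 0 T) :
    y t - y s = ∫ x in s..t, deriv y x := by
  have hi := h.integrable_deriv hT
  obtain ⟨g, hg, hy, h⟩ := h.exists_ae_hasDerivAt hT le_rfl
  have h0 : (0 : ℝ) ∈ Icc 0 T := ⟨le_rfl, hT.le⟩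
  have key : ∀ r ∈ Icc 0 T, y r = y 0 + ∫ x in (0 : ℝ)..r, deriv y x := by
    intro r hr
    rw [hy r hr]
    congr 1
    refine intervalIntegral_congr_Ioo h0 hr ?_
    filter_upwards [h] with t ht
    exact ht.deriv.symm
  rw [key t ht, key s hs, add_sub_add_left_eq_sub]
  exact intervalIntegral.integral_interval_sub_left (intervalIntegrable_of_Ioo h0 ht hi)
    (intervalIntegrable_of_Ioo h0 hs hi)

theorem MemW1p.continuousOn [CompleteSpace Y] {T : ℝ} (hT : 0 < T)
    {y : ℝ → Y} (h : MemW1p T 1 y) : ContinuousOn y (Icc 0 T) := by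
  have hi := h.integrable_deriv hT
  have h0 : (0 : ℝ) ∈ Icc 0 T := ⟨le_rfl, hT.le⟩
  have h1 : T ∈ Icc 0 T := ⟨hT.le, le_rfl⟩
  have hc := intervalIntegral.continuousOn_primitive_interval
    ((intervalIntegrable_iff').1 (intervalIntegrable_of_Ioo h0 h1 hi))
  rw [uIcc_of_le hT.le] at hc
  refine (hc.const_add (y 0)).congr fun t ht => ?_
  change y t = y 0 + ∫ s in (0 : ℝ)..t, deriv y s
  rw [← h.sub_eq_integral hT h0 ht, add_sub_cancel]

theorem MemW1p.mono {T : ℝ} {p q : ℝ≥0∞} (hpq : p ≤ q) {y : ℝ → Y} (h : MemW1p T q y) :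
    MemW1p T p y := by
  obtain ⟨g, hg, hy⟩ := h
  exact ⟨g, hg.mono_exponent hpq, hy⟩

theorem MemW1p.norm_sub_le [CompleteSpace Y] {T : ℝ} (hT : 0 < T)
    {y : ℝ → Y} (h : MemW1p T 1 y) {L : ℝ}
    (hL : ∀ᵐ t ∂volume.restrict (Ioo 0 T), ‖deriv y t‖ ≤ L) {s t : ℝ} (hs : s ∈ Icc 0 T)
    (ht : t ∈ Icc 0 T) : ‖y t - y s‖ ≤ L * |t - s| := by
  rw [h.sub_eq_integral hT hs ht]
  refine intervalIntegral.norm_integral_le_of_norm_le_const_ae ?_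
  exact (ae_restrict_iff' measurableSet_uIoc).1 (ae_restrict_uIoc hs ht hL)

theorem MemW1p.memW1p_top [CompleteSpace Y] {T : ℝ} (hT : 0 < T)
    {y : ℝ → Y} (h : MemW1p T 1 y) {L : ℝ}
    (hL : ∀ᵐ t ∂volume.restrict (Ioo 0 T), ‖deriv y t‖ ≤ L) : MemW1p T ∞ y := by
  have h0 : (0 : ℝ) ∈ Icc 0 T := ⟨le_rfl, hT.le⟩
  refine ⟨deriv y, memLp_top_of_bound (h.integrable_deriv hT).aestronglyMeasurable L hL, ?_⟩
  intro t ht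
  rw [← h.sub_eq_integral hT h0 ht, add_sub_cancel]

/-- The derivative is bounded by a Lipschitz constant. -/
theorem norm_deriv_le_of_forall_norm_sub_le {T L : ℝ} (hL : 0 ≤ L) {y : ℝ → Y}
    (hy : ∀ s ∈ Icc 0 T, ∀ t ∈ Icc 0 T, ‖y t - y s‖ ≤ L * |t - s|) {t : ℝ} (ht : t ∈ Ioo 0 T) :
    ‖deriv y t‖ ≤ L := by
  refine norm_deriv_le_of_lip' hL ?_
  filter_upwards [Ioo_mem_nhds ht.1 ht.2] with s hs
  exact hy t (Ioo_subset_Icc_self ht) s (Ioo_subset_Icc_self hs)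

/-! ### Real Lipschitz functions -/

/-- Lipschitz functions are absolutely continuous, so the fundamental theorem of calculus holds with
an almost everywhere derivative. -/
theorem sub_eq_integral_of_lipschitz {T K : ℝ} {f f' : ℝ → ℝ}
    (hf : ∀ s ∈ Icc 0 T, ∀ t ∈ Icc 0 T, ‖f t - f s‖ ≤ K * |t - s|)
    (hf' : ∀ᵐ t ∂volume.restrict (Ioo 0 T), HasDerivAt f (f' t) t)
    {s t : ℝ} (hs : s ∈ Icc 0 T) (ht : t ∈ Icc 0 T) :
    f t - f s = ∫ x in s..t, f' x := by
  have hL : LipschitzOnWith K.toNNReal f (uIcc s t) := by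
    refine LipschitzOnWith.of_dist_le_mul fun x hx z hz => ?_
    have hsub : uIcc s t ⊆ Icc 0 T := uIcc_subset_Icc hs ht
    rw [Real.dist_eq, Real.dist_eq]
    exact (hf z (hsub hz) x (hsub hx)).trans
      (mul_le_mul_of_nonneg_right (Real.le_coe_toNNReal K) (abs_nonneg _))
  rw [← hL.absolutelyContinuousOnInterval.integral_deriv_eq_sub]
  refine intervalIntegral_congr_Ioo hs ht ?_
  filter_upwards [hf'] with x hx
  exact hx.deriv

theorem ae_differentiableAt_of_lipschitz {T K : ℝ} (hT : 0 ≤ T) {f : ℝ → ℝ}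
    (hf : ∀ s ∈ Icc 0 T, ∀ t ∈ Icc 0 T, ‖f t - f s‖ ≤ K * |t - s|) :
    ∀ᵐ t ∂volume.restrict (Ioo 0 T), DifferentiableAt ℝ f t := by
  have hL : LipschitzOnWith K.toNNReal f (uIcc 0 T) := by
    refine LipschitzOnWith.of_dist_le_mul fun x hx z hz => ?_
    rw [uIcc_of_le hT] at hx hz
    rw [Real.dist_eq, Real.dist_eq]
    exact (hf z hz x hx).trans
      (mul_le_mul_of_nonneg_right (Real.le_coe_toNNReal K) (abs_nonneg _))
  rw [ae_restrict_iff' measurableSet_Ioo]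
  filter_upwards [hL.absolutelyContinuousOnInterval.ae_differentiableAt] with t ht hmem
  rw [uIcc_of_le hT] at ht
  exact ht (Ioo_subset_Icc_self hmem)

theorem le_of_ae_deriv_nonneg {T K : ℝ} {f f' : ℝ → ℝ}
    (hf : ∀ s ∈ Icc 0 T, ∀ t ∈ Icc 0 T, ‖f t - f s‖ ≤ K * |t - s|)
    (hf' : ∀ᵐ t ∂volume.restrict (Ioo 0 T), HasDerivAt f (f' t) t)
    (hnn : ∀ᵐ t ∂volume.restrict (Ioo 0 T), 0 ≤ f' t)
    {s t : ℝ} (hs : s ∈ Icc 0 T) (ht : t ∈ Icc 0 T) (hst : s ≤ t) : f s ≤ f t := by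
  rw [← sub_nonneg, sub_eq_integral_of_lipschitz hf hf' hs ht]
  refine intervalIntegral.integral_nonneg_of_ae_restrict hst ?_
  have := ae_restrict_uIoc hs ht hnn
  rw [uIoc_of_le hst] at this
  rwa [← restrict_Ioc_eq_restrict_Icc]

/-! ### The quadratic energy -/

section Quadratic

variable {A : Y →L[ℝ] StrongDual ℝ Y}

theorem phi_sub (hA : ∀ x y, A x y = A y x) (x y : Y) :
    phi A (x - y) = phi A x - A x y + phi A y := by
  simp only [phi, map_sub, sub_apply]
  rw [hA y x]; ring

theorem abs_phi_sub_phi_le (hA : ∀ x y, A x y = A y x) {x y : Y} {R : ℝ} (hx : ‖x‖ ≤ R)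
    (hy : ‖y‖ ≤ R) : ‖phi A x - phi A y‖ ≤ ‖A‖ * R * ‖x - y‖ := by
  have : phi A x - phi A y = 1 / 2 * A (x + y) (x - y) := by
    simp only [phi, map_add, map_sub, add_apply]
    rw [hA y x]; ring
  rw [this, norm_mul]
  have h1 := A.le_opNorm₂ (x + y) (x - y)
  have h2 : ‖x + y‖ ≤ 2 * R := (norm_add_le x y).trans (by linarith)
  have h3 : ‖A‖ * ‖x + y‖ * ‖x - y‖ ≤ ‖A‖ * (2 * R) * ‖x - y‖ := by gcongr
  rw [show ‖(1 / 2 : ℝ)‖ = 1 / 2 by norm_num]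
  linarith

theorem continuous_phi : Continuous (phi A) := by
  unfold phi
  fun_prop

theorem hasDerivAt_phi (hA : ∀ x y, A x y = A y x) {y : ℝ → Y} {y' : Y} {t : ℝ}
    (hy : HasDerivAt y y' t) : HasDerivAt (fun s => phi A (y s)) (A (y t) y') t := by
  have h1 : HasDerivAt (fun s => A (y s)) (A y') t := A.hasFDerivAt.comp_hasDerivAt t hy
  have h2 := (h1.clm_apply hy).const_mul (1 / 2 : ℝ)
  refine h2.congr_deriv ?_
  rw [hA y' (y t)]; ring

theorem norm_le_of_lipschitz {E : Type*} [NormedAddCommGroup E] {T L : ℝ} {y : ℝ → E} (hT : 0 ≤ T) (hL0 : 0 ≤ L)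
    (hL : ∀ s ∈ Icc 0 T, ∀ t ∈ Icc 0 T, ‖y t - y s‖ ≤ L * |t - s|) {t : ℝ} (ht : t ∈ Icc 0 T) :
    ‖y t‖ ≤ ‖y 0‖ + L * T := by
  have h1 := hL 0 ⟨le_rfl, hT⟩ t ht
  rw [sub_zero, abs_of_nonneg ht.1] at h1
  have h2 : L * t ≤ L * T := mul_le_mul_of_nonneg_left ht.2 hL0
  have h3 := norm_le_norm_add_norm_sub (y 0) (y t)
  rw [norm_sub_rev] at h3
  linarith

theorem phi_comp_lipschitz (hA : ∀ x y, A x y = A y x) {T L : ℝ} {y : ℝ → Y} (hT : 0 ≤ T)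
    (hL0 : 0 ≤ L) (hL : ∀ s ∈ Icc 0 T, ∀ t ∈ Icc 0 T, ‖y t - y s‖ ≤ L * |t - s|) :
    ∀ s ∈ Icc 0 T, ∀ t ∈ Icc 0 T,
      ‖phi A (y t) - phi A (y s)‖ ≤ ‖A‖ * (‖y 0‖ + L * T) * L * |t - s| := by
  intro s hs t ht
  refine (abs_phi_sub_phi_le hA (norm_le_of_lipschitz hT hL0 hL ht)
    (norm_le_of_lipschitz hT hL0 hL hs)).trans ?_
  rw [mul_assoc _ L]
  exact mul_le_mul_of_nonneg_left (hL s hs t ht) (by positivity)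

end Quadratic

/-! ### Dissipation potentials -/

/-- Homogeneity leaves only `0` and `∞` as values at the origin. Lower semicontinuity along `c • x →
0` with `ψ x` finite excludes `∞`. -/
theorem IsDissipation.map_zero {ψ : Y → EReal} (hψ : IsDissipation ψ) : ψ 0 = 0 := by
  have hb := hψ.proper.1
  obtain ⟨x, hx⟩ := hψ.proper.2
  have h2 := hψ.homogeneous 0 2 two_pos
  rw [smul_zero] at h2
  have htop : ψ 0 ≠ ⊤ := by
    intro h0
    have hl := hψ.lsc 0 (1 : EReal) (by simp only [h0]; exact EReal.coe_lt_top 1)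
    have hc : Tendsto (fun c : ℝ => c • x) (𝓝[>] 0) (𝓝 0) := by
      have : Tendsto (fun c : ℝ => c • x) (𝓝 0) (𝓝 ((0 : ℝ) • x)) :=
        (continuous_id.smul continuous_const).tendsto 0
      rw [zero_smul] at this
      exact this.mono_left nhdsWithin_le_nhds
    have h3 := hc.eventually hl
    lift ψ x to ℝ using ⟨hx, hb x⟩ with r hr
    have h4 : Tendsto (fun c : ℝ => c * r) (𝓝[>] 0) (𝓝 0) := by
      have : Tendsto (fun c : ℝ => c * r) (𝓝 0) (𝓝 ((0 : ℝ) * r)) :=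
        (continuous_id.mul continuous_const).tendsto 0
      rw [zero_mul] at this
      exact this.mono_left nhdsWithin_le_nhds
    have h5 := h4.eventually (gt_mem_nhds one_pos)
    obtain ⟨c, ⟨h6, h7⟩, hc0⟩ := ((h3.and h5).and self_mem_nhdsWithin).exists
    rw [hψ.homogeneous x c hc0, ← hr, ← EReal.coe_mul] at h6
    have h8 : (1 : ℝ) < c * r := by exact_mod_cast h6
    linarith
  lift ψ 0 to ℝ using ⟨htop, hb 0⟩ with r
  have h3 : r = 2 * r := by exact_mod_cast h2
  have h4 : r = 0 := by linarith
  rw [h4]; rfl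

/-- Closedness serves twice: it makes the conjugate measurable, and it extends stability from almost
every time to every time. -/
theorem isClosed_stable (ψ : Y → EReal) :
    IsClosed {ξ : StrongDual ℝ Y | ∀ v, ((ξ v : ℝ) : EReal) ≤ ψ v} := by
  simp only [ofPred_forall]
  refine isClosed_iInter fun v => isClosed_le ?_ continuous_const
  exact continuous_coe_real_ereal.comp (ContinuousLinearMap.apply ℝ ℝ v).continuous

theorem IsDissipation.conj_eq_zero {ψ : Y → EReal} (hψ : IsDissipation ψ) {ξ : StrongDual ℝ Y}
    (h : ∀ v, ((ξ v : ℝ) : EReal) ≤ ψ v) : conj ψ ξ = 0 := by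
  refine le_antisymm (iSup_le fun v => ?_) ?_
  · have h1 := h v
    have h2 := hψ.proper.1 v
    generalize ψ v = b at *
    induction b with
    | bot => exact absurd rfl h2
    | top => simp
    | coe b =>
      rw [EReal.coe_le_coe_iff] at h1
      rw [← EReal.coe_sub, ← EReal.coe_zero, EReal.coe_le_coe_iff]
      linarith
  · refine le_trans ?_ (le_iSup (fun v => ((ξ v : ℝ) : EReal) - ψ v) 0)
    simp [hψ.map_zero]

theorem IsDissipation.conj_eq_top {ψ : Y → EReal} (hψ : IsDissipation ψ) {ξ : StrongDual ℝ Y}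
    (h : ¬ ∀ v, ((ξ v : ℝ) : EReal) ≤ ψ v) : conj ψ ξ = ⊤ := by
  push Not at h
  obtain ⟨v, hv⟩ := h
  have hb := hψ.proper.1 v
  have ht : ψ v ≠ ⊤ := ne_top_of_lt hv
  lift ψ v to ℝ using ⟨ht, hb⟩ with r hr
  have hv' : 0 < ξ v - r := sub_pos.2 (EReal.coe_lt_coe_iff.1 hv)
  rw [EReal.eq_top_iff_forall_lt]
  intro M
  have hle : ∀ c : ℝ, 0 < c → ((c * (ξ v - r) : ℝ) : EReal) ≤ conj ψ ξ := by
    intro c hc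
    refine le_trans (le_of_eq ?_) (le_iSup (fun v => ((ξ v : ℝ) : EReal) - ψ v) (c • v))
    rw [hψ.homogeneous v c hc, ← hr, ← EReal.coe_mul, ← EReal.coe_sub, map_smul, smul_eq_mul,
      mul_sub]
  -- Moving along the ray through `v` makes the supremum unbounded; this scale produces the value
  -- `|M| + 1`.
  refine lt_of_lt_of_le ?_ (hle ((|M| + 1) / (ξ v - r)) (by positivity))
  rw [div_mul_cancel₀ _ hv'.ne', EReal.coe_lt_coe_iff]
  linarith [le_abs_self M]

/-- The conjugate is the indicator of the stable set, so a vanishing integrand forces stability, and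
what remains is the flow rule. -/
theorem IsDissipation.lagrangian_eq_zero_iff {ψ : Y → EReal} (hψ : IsDissipation ψ)
    (A : Y →L[ℝ] StrongDual ℝ Y) (ξ : StrongDual ℝ Y) (y p : Y) :
    lagrangian ψ A ξ y p = 0 ↔
      (∀ v, (((ξ - A y) v : ℝ) : EReal) ≤ ψ v) ∧ ψ p = (((ξ - A y) p : ℝ) : EReal) := by
  unfold lagrangian
  by_cases h : ∀ v, (((ξ - A y) v : ℝ) : EReal) ≤ ψ v
  · rw [hψ.conj_eq_zero h, add_zero]
    simp only [h, implies_true, true_and]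
    have hb := hψ.proper.1 p
    generalize (ξ - A y) p = a
    generalize ψ p = b at *
    induction b with
    | bot => exact absurd rfl hb
    | top => simp
    | coe b =>
      rw [← EReal.coe_sub, ← EReal.coe_zero, EReal.coe_eq_coe_iff, EReal.coe_eq_coe_iff, sub_eq_zero]
  · rw [hψ.conj_eq_top h, EReal.add_top_of_ne_bot (hψ.proper.1 p), EReal.top_sub_coe]
    simp only [h, false_and, iff_false]
    exact EReal.top_ne_zero

/-- Needed to conclude from a zero integral that the nonnegative integrand vanishes almost
everywhere. -/
theorem IsDissipation.aemeasurable_lagrangian {ψ : Y → EReal} (hψ : IsDissipation ψ)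
    (A : Y →L[ℝ] StrongDual ℝ Y) {μ : Measure ℝ} {ξ : ℝ → StrongDual ℝ Y} {y p : ℝ → Y}
    (hξ : AEStronglyMeasurable ξ μ) (hy : AEStronglyMeasurable y μ)
    (hp : AEStronglyMeasurable p μ) :
    AEMeasurable (fun t => lagrangian ψ A (ξ t) (y t) (p t)) μ := by
  classical
  borelize Y
  borelize (StrongDual ℝ Y)
  have h1 : AEMeasurable (fun t => ψ (p t)) μ := hψ.lsc.measurable.comp_aemeasurable hp.aemeasurable
  have h2 : AEStronglyMeasurable (fun t => ξ t - A (y t)) μ :=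
    hξ.sub (A.continuous.comp_aestronglyMeasurable hy)
  have h3 : Measurable (conj ψ) := by
    have : conj ψ = fun ξ => if ξ ∈ {ξ : StrongDual ℝ Y | ∀ v, ((ξ v : ℝ) : EReal) ≤ ψ v}
        then 0 else ⊤ := by
      funext ξ
      split_ifs with h
      · exact hψ.conj_eq_zero h
      · exact hψ.conj_eq_top h
    rw [this]
    exact Measurable.ite (isClosed_stable ψ).measurableSet measurable_const measurable_const
  have h4 : AEMeasurable (fun t => (((ξ t - A (y t)) (p t) : ℝ) : EReal)) μ := by
    have : AEStronglyMeasurable (fun t => (ξ t - A (y t)) (p t)) μ := by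
      exact (isBoundedBilinearMap_apply.continuous).comp_aestronglyMeasurable (h2.prodMk hp)
    exact this.aemeasurable.coe_real_ereal
  unfold lagrangian
  simp only [sub_eq_add_neg] at h2 h4 ⊢
  exact (h1.add (h3.comp_aemeasurable h2.aemeasurable)).add
    (continuous_neg.measurable.comp_aemeasurable h4)

/-! ### Evolutions -/

/-- Pointwise form of the equation: stability at all times and the flow rule at almost all times. -/
structure IsEvolution (T : ℝ) (ψ : Y → EReal) (A : Y →L[ℝ] StrongDual ℝ Y)
    (ℓ : ℝ → StrongDual ℝ Y) (y : ℝ → Y) : Prop where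
  mem : MemW1p T 1 y
  stable : ∀ t ∈ Icc 0 T, ∀ v, (((ℓ t - A (y t)) v : ℝ) : EReal) ≤ ψ v
  flow : ∀ᵐ t ∂volume.restrict (Ioo 0 T),
    ψ (deriv y t) = (((ℓ t - A (y t)) (deriv y t) : ℝ) : EReal)

/-- The exceptional times in `Ioo 0 T` form an open null set, which is empty; the endpoints follow
by closure. -/
theorem mem_of_ae_mem_of_isClosed {X : Type*} [TopologicalSpace X] {T : ℝ} (hT : 0 < T)
    {f : ℝ → X} (hf : ContinuousOn f (Icc 0 T)) {C : Set X} (hC : IsClosed C)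
    (h : ∀ᵐ t ∂volume.restrict (Ioo 0 T), f t ∈ C) {t : ℝ} (ht : t ∈ Icc 0 T) : f t ∈ C := by
  have hG : IsClosed (Icc 0 T ∩ f ⁻¹' C) := hf.preimage_isClosed_of_isClosed isClosed_Icc hC
  have hU : IsOpen (Ioo 0 T \ (Icc 0 T ∩ f ⁻¹' C)) := isOpen_Ioo.sdiff hG
  have hU0 : volume (Ioo 0 T \ (Icc 0 T ∩ f ⁻¹' C)) = 0 := by
    rw [ae_restrict_iff' measurableSet_Ioo] at h
    refine measure_mono_null ?_ h
    rintro x ⟨hx, hx'⟩ hx2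
    exact hx' ⟨Ioo_subset_Icc_self hx, hx2 hx⟩
  have hsub : Ioo 0 T ⊆ Icc 0 T ∩ f ⁻¹' C :=
    sdiff_eq_empty.1 (hU.measure_eq_zero_iff volume |>.1 hU0)
  have := hG.closure_subset_iff.2 hsub
  rw [closure_Ioo hT.ne] at this
  exact (this ht).2

theorem lagrangian_lintegral_eq_zero_iff [CompleteSpace Y] {T : ℝ} (hT : 0 < T) {ψ : Y → EReal}
    (hψ : IsDissipation ψ) {A : Y →L[ℝ] StrongDual ℝ Y} {ℓ : ℝ → StrongDual ℝ Y}
    (hℓ : ContinuousOn ℓ (Icc 0 T)) {y : ℝ → Y} (hy : MemW1p T 1 y) :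
    ∫⁻ t in Ioo 0 T, (lagrangian ψ A (ℓ t) (y t) (deriv y t)).toENNReal = 0 ↔
      IsEvolution T ψ A ℓ y := by
  have hyc := hy.continuousOn hT
  have hsub : Ioo 0 T ⊆ Icc 0 T := Ioo_subset_Icc_self
  have hm := (hψ.aemeasurable_lagrangian A (μ := volume.restrict (Ioo 0 T))
    ((hℓ.mono hsub).aestronglyMeasurable measurableSet_Ioo)
    ((hyc.mono hsub).aestronglyMeasurable measurableSet_Ioo)
    (hy.integrable_deriv hT).aestronglyMeasurable).ereal_toENNReal
  rw [lintegral_eq_zero_iff' hm]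
  have hiff : ∀ t, (lagrangian ψ A (ℓ t) (y t) (deriv y t)).toENNReal = 0 ↔
      lagrangian ψ A (ℓ t) (y t) (deriv y t) = 0 := by
    intro t
    rw [EReal.toENNReal_eq_zero_iff]
    exact ⟨fun h => le_antisymm h (lagrangian_nonneg hψ.proper _ _ _ _), fun h => h.le⟩
  have hξ : ContinuousOn (fun t => ℓ t - A (y t)) (Icc 0 T) :=
    hℓ.sub (A.continuous.comp_continuousOn hyc)
  constructor
  · intro h
    have h' : ∀ᵐ t ∂volume.restrict (Ioo 0 T),
        (∀ v, (((ℓ t - A (y t)) v : ℝ) : EReal) ≤ ψ v) ∧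
          ψ (deriv y t) = (((ℓ t - A (y t)) (deriv y t) : ℝ) : EReal) := by
      filter_upwards [h] with t ht
      exact (hψ.lagrangian_eq_zero_iff A _ _ _).1 ((hiff t).1 ht)
    refine ⟨hy, fun t ht => ?_, h'.mono fun t ht => ht.2⟩
    exact mem_of_ae_mem_of_isClosed hT hξ (isClosed_stable ψ) (h'.mono fun t ht => ht.1) ht
  · intro h
    filter_upwards [h.flow, ae_restrict_mem measurableSet_Ioo] with t ht hmem
    exact (hiff t).2 ((hψ.lagrangian_eq_zero_iff A _ _ _).2 ⟨h.stable t (hsub hmem), ht⟩)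

theorem chi_nonneg {A : Y →L[ℝ] StrongDual ℝ Y} (hχ : ∀ y, y ≠ 0 → 0 < chi A y) (y : Y) :
    0 ≤ chi A y := by
  by_cases h : y = 0
  · simp [h, chi, phi]
  · exact (hχ y h).le

theorem chi_eq_zero_iff {A : Y →L[ℝ] StrongDual ℝ Y} (hχ : ∀ y, y ≠ 0 → 0 < chi A y) (y : Y) :
    chi A y = 0 ↔ y = 0 := by
  refine ⟨fun h => ?_, fun h => by simp [h, chi, phi]⟩
  by_contra h'
  exact (hχ y h').ne' h

theorem F_eq_zero_iff [CompleteSpace Y] {T : ℝ} (hT : 0 < T) {ψ : Y → EReal}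
    (hψ : IsDissipation ψ) {A : Y →L[ℝ] StrongDual ℝ Y} (hχ : ∀ y, y ≠ 0 → 0 < chi A y)
    {ℓ : ℝ → StrongDual ℝ Y} (hℓ : ContinuousOn ℓ (Icc 0 T)) {y : ℝ → Y} (hy : MemW1p T 1 y)
    (y₀ : Y) : F T ψ A ℓ y₀ y = 0 ↔ IsEvolution T ψ A ℓ y ∧ y 0 = y₀ := by
  rw [← lagrangian_lintegral_eq_zero_iff hT hψ hℓ hy, F,
    add_eq_zero_iff_of_nonneg (EReal.coe_ennreal_nonneg _)
      (EReal.coe_nonneg.2 (chi_nonneg hχ _)), EReal.coe_ennreal_eq_zero, EReal.coe_eq_zero,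
    chi_eq_zero_iff hχ, sub_eq_zero]

/-- Restricting to `V` only replaces values by `∞`, so `FSub` dominates the functional `F` with the
same data, and the latter is nonnegative. -/
theorem isEvolution_of_FSub_eq_zero [CompleteSpace Y] {T : ℝ} (hT : 0 < T) {V : Submodule ℝ Y}
    {ψ : Y → EReal} (hψ : IsDissipation ψ) {A : Y →L[ℝ] StrongDual ℝ Y}
    (hχ : ∀ y, y ≠ 0 → 0 < chi A y)
    {ℓ : ℝ → StrongDual ℝ Y} (hℓ : ContinuousOn ℓ (Icc 0 T)) {y : ℝ → Y} (hy : MemW1p T 1 y)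
    {y₀ : Y} (h : FSub T V ψ A ℓ y₀ y = 0) : IsEvolution T ψ A ℓ y ∧ y 0 = y₀ := by
  have hc : ((chi A (y 0 - y₀) : ℝ) : EReal) ≤ chiSub V A (y 0 - y₀) := by
    unfold chiSub phiSub
    split_ifs
    · rw [← EReal.coe_add]; rfl
    · rw [EReal.top_add_coe]; exact le_top
  have hl : ∫⁻ t in Ioo 0 T, (lagrangian ψ A (ℓ t) (y t) (deriv y t)).toENNReal ≤
      ∫⁻ t in Ioo 0 T, (lagrangianSub V ψ A (ℓ t) (y t) (deriv y t)).toENNReal := by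
    refine lintegral_mono fun t => EReal.toENNReal_le_toENNReal ?_
    unfold lagrangianSub
    split_ifs
    · exact le_rfl
    · exact le_top
  have hF : F T ψ A ℓ y₀ y ≤ 0 := by
    rw [← h]
    exact add_le_add (EReal.coe_ennreal_le_coe_ennreal_iff.2 hl) hc
  rw [← F_eq_zero_iff hT hψ hχ hℓ hy]
  refine le_antisymm hF ?_
  exact add_nonneg (EReal.coe_ennreal_nonneg _) (EReal.coe_nonneg.2 (chi_nonneg hχ _))

/-! ### Jensen's inequality -/

theorem IsDissipation.isClosed_epigraph {ψ : Y → EReal} (hψ : IsDissipation ψ) :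
    IsClosed {q : Y × ℝ | ψ q.1 ≤ (q.2 : EReal)} := by
  have h := hψ.lsc.isClosed_epigraph
  exact h.preimage (continuous_fst.prodMk (continuous_coe_real_ereal.comp continuous_snd))

theorem IsDissipation.convex_epigraph {ψ : Y → EReal} (hψ : IsDissipation ψ) :
    Convex ℝ {q : Y × ℝ | ψ q.1 ≤ (q.2 : EReal)} := by
  rw [convex_iff_forall_pos]
  rintro ⟨x, r⟩ hx ⟨z, s⟩ hz a b ha hb hab
  simp only [mem_ofPred_eq] at hx hz ⊢
  refine (hψ.convex x z a b ha hb hab).trans ?_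
  have h1 : (a : EReal) * ψ x ≤ a * r := mul_le_mul_of_nonneg_left hx (EReal.coe_nonneg.2 ha.le)
  have h2 : (b : EReal) * ψ z ≤ b * s := mul_le_mul_of_nonneg_left hz (EReal.coe_nonneg.2 hb.le)
  refine (add_le_add h1 h2).trans (le_of_eq ?_)
  simp

/-- Jensen's inequality: the average of `(f, g)` stays in the closed convex epigraph. Homogeneity
cancels the factor `1 / (t - s)`, so the bound holds for integrals rather than averages. -/
theorem IsDissipation.le_intervalIntegral [CompleteSpace Y] {ψ : Y → EReal}
    (hψ : IsDissipation ψ) {f : ℝ → Y} {g : ℝ → ℝ} {s t : ℝ} (hst : s ≤ t)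
    (hf : IntervalIntegrable f volume s t) (hg : IntervalIntegrable g volume s t)
    (h : ∀ᵐ x ∂volume.restrict (Ioc s t), ψ (f x) ≤ (g x : EReal)) :
    ψ (∫ x in s..t, f x) ≤ ((∫ x in s..t, g x : ℝ) : EReal) := by
  rcases hst.eq_or_lt with rfl | hlt
  · simp [hψ.map_zero]
  have hpos : 0 < t - s := sub_pos.2 hlt
  have hfi := (intervalIntegrable_iff_integrableOn_Ioc_of_le hst).1 hf
  have hgi := (intervalIntegrable_iff_integrableOn_Ioc_of_le hst).1 hg
  have hmem := hψ.convex_epigraph.set_average_mem hψ.isClosed_epigraph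
    (μ := volume) (t := Ioc s t) (f := fun x => (f x, g x))
    (by simpa using hlt) (by simp) h (hfi.prodMk hgi)
  rw [setAverage_eq, integral_pair hfi hgi, measureReal_def, Real.volume_Ioc,
    ENNReal.toReal_ofReal hpos.le] at hmem
  simp only [Prod.smul_mk, mem_ofPred_eq, smul_eq_mul] at hmem
  rw [hψ.homogeneous _ _ (inv_pos.2 hpos)] at hmem
  rw [intervalIntegral.integral_of_le hst, intervalIntegral.integral_of_le hst]
  have h2 := mul_le_mul_of_nonneg_left hmem (EReal.coe_nonneg.2 hpos.le)
  rwa [← mul_assoc, ← EReal.coe_mul, ← EReal.coe_mul, mul_inv_cancel₀ hpos.ne', EReal.coe_one,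
    one_mul, mul_inv_cancel_left₀ hpos.ne'] at h2

theorem aestronglyMeasurable_apply {μ : Measure ℝ} {ξ : ℝ → StrongDual ℝ Y} {p : ℝ → Y}
    (hξ : AEStronglyMeasurable ξ μ) (hp : AEStronglyMeasurable p μ) :
    AEStronglyMeasurable (fun t => ξ t (p t)) μ :=
  (isBoundedBilinearMap_apply.continuous).comp_aestronglyMeasurable (hξ.prodMk hp)

theorem integrable_apply_of_continuousOn {T : ℝ} {ξ : ℝ → StrongDual ℝ Y}
    (hξ : ContinuousOn ξ (Icc 0 T)) {p : ℝ → Y} (hp : Integrable p (volume.restrict (Ioo 0 T))) :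
    Integrable (fun t => ξ t (p t)) (volume.restrict (Ioo 0 T)) := by
  obtain ⟨C, hC⟩ := isCompact_Icc.exists_bound_of_continuousOn hξ
  refine Integrable.mono' (hp.norm.const_mul C)
    (aestronglyMeasurable_apply ((hξ.mono Ioo_subset_Icc_self).aestronglyMeasurable
      measurableSet_Ioo) hp.aestronglyMeasurable) ?_
  filter_upwards [ae_restrict_mem measurableSet_Ioo] with t ht
  exact ((ξ t).le_opNorm _).trans
    (mul_le_mul_of_nonneg_right (hC t (Ioo_subset_Icc_self ht)) (norm_nonneg _))

theorem integrable_apply_of_bound {T L : ℝ} {w : ℝ → StrongDual ℝ Y}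
    (hw : Integrable w (volume.restrict (Ioo 0 T))) {p : ℝ → Y}
    (hp : AEStronglyMeasurable p (volume.restrict (Ioo 0 T)))
    (hL : ∀ᵐ t ∂volume.restrict (Ioo 0 T), ‖p t‖ ≤ L) :
    Integrable (fun t => w t (p t)) (volume.restrict (Ioo 0 T)) := by
  refine Integrable.mono' (hw.norm.mul_const L)
    (aestronglyMeasurable_apply hw.aestronglyMeasurable hp) ?_
  filter_upwards [hL] with t ht
  exact ((w t).le_opNorm _).trans (mul_le_mul_of_nonneg_left ht (norm_nonneg _))

/-! ### Estimates for evolutions -/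

section Estimates

variable {T : ℝ} {ψ : Y → EReal} {A : Y →L[ℝ] StrongDual ℝ Y} {ℓ : ℝ → StrongDual ℝ Y} {y z : ℝ → Y}

theorem IsEvolution.continuousOn_force [CompleteSpace Y] (hT : 0 < T)
    (h : IsEvolution T ψ A ℓ y) (hℓ : ContinuousOn ℓ (Icc 0 T)) :
    ContinuousOn (fun t => ℓ t - A (y t)) (Icc 0 T) :=
  hℓ.sub (A.continuous.comp_continuousOn (h.mem.continuousOn hT))

/-- The dissipation of an increment is bounded by the power of the driving force. -/
theorem IsEvolution.dissipation_sub_le [CompleteSpace Y] (hT : 0 < T) (hψ : IsDissipation ψ)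
    (h : IsEvolution T ψ A ℓ y) (hℓ : ContinuousOn ℓ (Icc 0 T)) {s t : ℝ} (hs : s ∈ Icc 0 T)
    (ht : t ∈ Icc 0 T) (hst : s ≤ t) :
    ψ (y t - y s) ≤ ((∫ x in s..t, (ℓ x - A (y x)) (deriv y x) : ℝ) : EReal) := by
  have hi := h.mem.integrable_deriv hT
  rw [h.mem.sub_eq_integral hT hs ht]
  refine hψ.le_intervalIntegral hst (intervalIntegrable_of_Ioo hs ht hi)
    (intervalIntegrable_of_Ioo hs ht
      (integrable_apply_of_continuousOn (h.continuousOn_force hT hℓ) hi)) ?_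
  have := ae_restrict_uIoc hs ht h.flow
  rw [uIoc_of_le hst] at this
  filter_upwards [this] with x hx
  exact hx.le

/-- This places the difference of two increments in `dom ψ - dom ψ`, the only set where `φ` is known
to be coercive. -/
theorem IsEvolution.sub_mem_dom [CompleteSpace Y] (hT : 0 < T) (hψ : IsDissipation ψ)
    (h : IsEvolution T ψ A ℓ y) (hℓ : ContinuousOn ℓ (Icc 0 T)) {s t : ℝ} (hs : s ∈ Icc 0 T)
    (ht : t ∈ Icc 0 T) (hst : s ≤ t) : y t - y s ∈ dom ψ :=
  (h.dissipation_sub_le hT hψ hℓ hs ht hst).trans_lt (EReal.coe_lt_top _)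

/-- Evolutions driven by a Lipschitz load are Lipschitz. -/
theorem IsEvolution.norm_deriv_le [CompleteSpace Y] (hT : 0 < T) (hψ : IsDissipation ψ)
    {α : ℝ} (hα : 0 < α) (hcoerc : ∀ y ∈ dom ψ - dom ψ, α / 2 * ‖y‖ ^ 2 ≤ phi A y)
    (h : IsEvolution T ψ A ℓ y) {K : ℝ≥0} (hℓ : LipschitzOnWith K ℓ (Icc 0 T)) :
    ∀ᵐ t ∂volume.restrict (Ioo 0 T), ‖deriv y t‖ ≤ K / α := by
  filter_upwards [h.flow, h.mem.ae_hasDerivAt hT, ae_restrict_mem measurableSet_Ioo]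
    with t hflow hder ht
  set p := deriv y t
  have htI := Ioo_subset_Icc_self ht
  -- Stability at the earlier time `s`, tested with the velocity at `t`, is subtracted from the flow
  -- rule at `t`. Only left slopes give the right sign.
  have hle : ∀ᶠ s in 𝓝[<] t, A (slope y t s) p ≤ K * ‖p‖ := by
    filter_upwards [self_mem_nhdsWithin, mem_nhdsWithin_of_mem_nhds (Ioo_mem_nhds ht.1 ht.2)]
      with s hst hs
    have hsI := Ioo_subset_Icc_self hs
    have hst' : 0 < t - s := sub_pos.2 hst
    have h1 := h.stable s hsI p
    rw [hflow, EReal.coe_le_coe_iff] at h1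
    simp only [sub_apply] at h1
    have h2 : ‖ℓ t - ℓ s‖ ≤ K * (t - s) := by
      have := hℓ.dist_le_mul t htI s hsI
      rwa [dist_eq_norm, Real.dist_eq, abs_of_pos hst'] at this
    have h3 : (ℓ t - ℓ s) p ≤ K * (t - s) * ‖p‖ :=
      (le_abs_self _).trans (((ℓ t - ℓ s).le_opNorm p).trans
        (mul_le_mul_of_nonneg_right h2 (norm_nonneg _)))
    rw [sub_apply] at h3
    rw [slope_def_module, ← neg_sub t s, ← neg_sub (y t) (y s), inv_neg, neg_smul_neg, map_smul,
      smul_apply, smul_eq_mul, map_sub, sub_apply, inv_mul_le_iff₀ hst']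
    linarith
  have hlim : Tendsto (fun s => A (slope y t s) p) (𝓝[<] t) (𝓝 (A p p)) := by
    have h1 : Tendsto (slope y t) (𝓝[<] t) (𝓝 p) :=
      hder.tendsto_slope.mono_left (nhdsWithin_mono _ fun s hs => (mem_Iio.1 hs).ne)
    have h2 : Continuous fun q => A q p := by fun_prop
    exact (h2.tendsto p).comp h1
  have h4 : A p p ≤ K * ‖p‖ := le_of_tendsto hlim hle
  have h5 : α / 2 * ‖p‖ ^ 2 ≤ phi A p := by
    refine hcoerc p ⟨p, ?_, 0, ?_, sub_zero p⟩
    · change ψ p < ⊤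
      rw [hflow]; exact EReal.coe_lt_top _
    · change ψ 0 < ⊤
      rw [hψ.map_zero]; exact EReal.zero_lt_top
  rw [phi] at h5
  rw [le_div_iff₀ hα]
  by_contra! hcon
  have hp : 0 < ‖p‖ := by
    by_contra! hp
    have : ‖p‖ = 0 := le_antisymm hp (norm_nonneg _)
    rw [this, zero_mul] at hcon
    exact absurd hcon (not_lt.2 K.coe_nonneg)
  nlinarith [mul_lt_mul_of_pos_right hcon hp]

theorem IsEvolution.lipschitz [CompleteSpace Y] (hT : 0 < T) (hψ : IsDissipation ψ)
    {α : ℝ} (hα : 0 < α) (hcoerc : ∀ y ∈ dom ψ - dom ψ, α / 2 * ‖y‖ ^ 2 ≤ phi A y)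
    (h : IsEvolution T ψ A ℓ y) {K : ℝ≥0} (hℓ : LipschitzOnWith K ℓ (Icc 0 T)) :
    ∀ s ∈ Icc 0 T, ∀ t ∈ Icc 0 T, ‖y t - y s‖ ≤ K / α * |t - s| :=
  fun _ hs _ ht => h.mem.norm_sub_le hT (h.norm_deriv_le hT hψ hα hcoerc hℓ) hs ht

/-- Evolutions are determined by their initial value. -/
theorem IsEvolution.eqOn [CompleteSpace Y] (hA : ∀ x y, A x y = A y x) (hT : 0 < T)
    (hψ : IsDissipation ψ)
    {α : ℝ} (hα : 0 < α) (hcoerc : ∀ y ∈ dom ψ - dom ψ, α / 2 * ‖y‖ ^ 2 ≤ phi A y)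
    {K : ℝ≥0} (hℓ : LipschitzOnWith K ℓ (Icc 0 T)) (hz : IsEvolution T ψ A ℓ z)
    (hy : IsEvolution T ψ A ℓ y) (h0 : z 0 = y 0) : EqOn z y (Icc 0 T) := by
  intro t ht
  have h0I : (0 : ℝ) ∈ Icc 0 T := ⟨le_rfl, hT.le⟩
  have hL0 : 0 ≤ K / α := by positivity
  have hLw : ∀ s ∈ Icc 0 T, ∀ t ∈ Icc 0 T,
      ‖(z t - y t) - (z s - y s)‖ ≤ (K / α + K / α) * |t - s| := by
    intro s hs t ht
    rw [sub_sub_sub_comm, add_mul]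
    exact (norm_sub_le _ _).trans (add_le_add (hz.lipschitz hT hψ hα hcoerc hℓ s hs t ht)
      (hy.lipschitz hT hψ hα hcoerc hℓ s hs t ht))
  have hphi := phi_comp_lipschitz hA hT.le (add_nonneg hL0 hL0) hLw
  have hder : ∀ᵐ t ∂volume.restrict (Ioo 0 T),
      HasDerivAt (fun t => -phi A (z t - y t)) (-A (z t - y t) (deriv z t - deriv y t)) t := by
    filter_upwards [hz.mem.ae_hasDerivAt hT, hy.mem.ae_hasDerivAt hT] with t h1 h2
    exact (hasDerivAt_phi hA (h1.sub h2)).neg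
  -- Monotonicity is applied to `-φ(z - y)`; the sign of its derivative is the last goal, where
  -- stability of each evolution is tested with the velocity of the other.
  have hmono := le_of_ae_deriv_nonneg (f := fun t => -phi A (z t - y t))
    (fun s hs t ht => by
      have := hphi s hs t ht
      rwa [neg_sub_neg, norm_sub_rev]) hder ?_ h0I ht ht.1
  · have hw : z t - y t ∈ dom ψ - dom ψ := by
      refine ⟨z t - z 0, hz.sub_mem_dom hT hψ hℓ.continuousOn h0I ht ht.1,
        y t - y 0, hy.sub_mem_dom hT hψ hℓ.continuousOn h0I ht ht.1, ?_⟩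
      simp only [h0, sub_sub_sub_cancel_right]
    have h1 := hcoerc _ hw
    have h2 : phi A (z 0 - y 0) = 0 := by simp [h0, phi]
    rw [h2] at hmono
    have h3 : α / 2 * ‖z t - y t‖ ^ 2 ≤ 0 := by linarith
    have h4 : ‖z t - y t‖ ^ 2 ≤ 0 := by
      by_contra! h5
      have : 0 < α / 2 * ‖z t - y t‖ ^ 2 := by positivity
      linarith
    have h5 : ‖z t - y t‖ = 0 := by
      have := sq_nonneg ‖z t - y t‖
      exact pow_eq_zero_iff two_ne_zero |>.1 (le_antisymm h4 this)
    exact sub_eq_zero.1 (norm_eq_zero.1 h5)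
  · filter_upwards [hz.flow, hy.flow, ae_restrict_mem measurableSet_Ioo] with t h1 h2 ht
    have htI := Ioo_subset_Icc_self ht
    have h3 := hy.stable t htI (deriv z t)
    have h4 := hz.stable t htI (deriv y t)
    rw [h1, EReal.coe_le_coe_iff] at h3
    rw [h2, EReal.coe_le_coe_iff] at h4
    simp only [map_sub, sub_apply] at h3 h4 ⊢
    linarith

end Estimates

/-! ### Weak limits in separable reflexive spaces -/

/-- The dual of a separable reflexive space is separable. -/
theorem separableSpace_dual_of_reflexive [TopologicalSpace.SeparableSpace Y]
    (hrefl : Function.Surjective (NormedSpace.inclusionInDoubleDual ℝ Y)) :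
    TopologicalSpace.SeparableSpace (StrongDual ℝ Y) := by
  obtain ⟨d, hd⟩ := TopologicalSpace.exists_dense_seq Y
  choose f hf1 hf using fun n => exists_dual_vector'' ℝ (d n)
  have htop : closure (Submodule.span ℝ (range f) : Set (StrongDual ℝ Y)) = univ := by
    rw [eq_univ_iff_forall]
    by_contra! h
    obtain ⟨ξ, hξ⟩ := h
    obtain ⟨Λ, s, hs, hsξ⟩ := geometric_hahn_banach_closed_point
      (Submodule.convex _).closure isClosed_closure hξ
    obtain ⟨y, rfl⟩ := hrefl Λ
    simp only [NormedSpace.dual_def] at hs hsξ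
    have hs0 : 0 < s := by
      have := hs 0 (subset_closure (Submodule.zero_mem _))
      simpa using this
    -- A linear functional bounded above on a subspace vanishes there; otherwise a multiple of `f n`
    -- would attain the value `s`.
    have hz : ∀ n, f n y = 0 := by
      intro n
      by_contra hne
      have h1 := hs ((s / f n y) • f n) (subset_closure
        (Submodule.smul_mem _ _ (Submodule.subset_span (mem_range_self n))))
      rw [smul_apply, smul_eq_mul, div_mul_cancel₀ _ hne] at h1
      exact lt_irrefl _ h1
    have hy : y = 0 := by
      by_contra hne
      have hpos : 0 < ‖y‖ / 2 := by positivity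
      obtain ⟨n, hn⟩ := hd.exists_dist_lt y hpos
      -- `f n` norms `d n` and annihilates `y`. Thus `d n` cannot be closer to `y` than `‖y‖ / 2`,
      -- contrary to density.
      have h1 : ‖d n‖ ≤ ‖d n - y‖ := by
        have h2 : f n (d n - y) = ‖d n‖ := by rw [map_sub, hz, sub_zero]; exact hf n
        rw [← h2]
        refine (le_abs_self _).trans (((f n).le_opNorm _).trans ?_)
        exact mul_le_of_le_one_left (norm_nonneg _) (hf1 n)
      rw [dist_eq_norm] at hn
      have h3 := norm_le_norm_add_norm_sub (d n) y
      rw [norm_sub_rev] at hn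
      linarith
    rw [hy, map_zero] at hsξ
    linarith
  have hsep : TopologicalSpace.IsSeparable (univ : Set (StrongDual ℝ Y)) := by
    rw [← htop]
    exact ((countable_range f).isSeparable.span (R := ℝ)).closure
  exact TopologicalSpace.isSeparable_univ_iff.1 hsep

/-- A bounded family that converges against a dense set of functionals converges weakly. -/
theorem exists_weak_limit
    (hrefl : Function.Surjective (NormedSpace.inclusionInDoubleDual ℝ Y)) {ι : Type*}
    {l : Filter ι} [l.NeBot] {u : ι → Y} {R : ℝ} (hR : ∀ᶠ i in l, ‖u i‖ ≤ R)
    {S : Set (StrongDual ℝ Y)} (hS : Dense S)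
    (h : ∀ ξ ∈ S, ∃ c, Tendsto (fun i => ξ (u i)) l (𝓝 c)) :
    ∃ y, ‖y‖ ≤ R ∧ ∀ ξ : StrongDual ℝ Y, Tendsto (fun i => ξ (u i)) l (𝓝 (ξ y)) := by
  have hR0 : 0 ≤ R := by
    obtain ⟨i, hi⟩ := hR.exists
    exact (norm_nonneg _).trans hi
  have hall : ∀ ξ : StrongDual ℝ Y, ∃ c, Tendsto (fun i => ξ (u i)) l (𝓝 c) := by
    intro ξ
    rw [← cauchy_map_iff_exists_tendsto, Metric.cauchy_iff]
    refine ⟨inferInstance, fun ε hε => ?_⟩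
    -- Replacing `ξ` by `η` costs at most `ε / 4` on the ball of radius `R`; the `+ 1` covers `R =
    -- 0`.
    obtain ⟨η, hηS, hη⟩ := hS.exists_dist_lt ξ (ε := ε / (4 * (R + 1))) (by positivity)
    obtain ⟨c, hc⟩ := h η hηS
    have hη' : ‖ξ - η‖ * R ≤ ε / 4 := by
      rw [dist_eq_norm] at hη
      have h1 : ‖ξ - η‖ * R ≤ ε / (4 * (R + 1)) * (R + 1) :=
        mul_le_mul hη.le (by linarith) hR0 (by positivity)
      refine h1.trans (le_of_eq ?_)
      field_simp
    refine ⟨Metric.ball c (ε / 2), ?_, ?_⟩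
    · rw [mem_map]
      filter_upwards [hR, hc.eventually (Metric.ball_mem_nhds c (by positivity : 0 < ε / 4))]
        with i hi hi'
      rw [Real.dist_eq] at hi'
      rw [mem_preimage, Metric.mem_ball, Real.dist_eq]
      have h2 : |ξ (u i) - η (u i)| ≤ ε / 4 := by
        rw [← sub_apply]
        exact ((ξ - η).le_opNorm _).trans
          ((mul_le_mul_of_nonneg_left hi (norm_nonneg _)).trans hη')
      have h3 := abs_sub_le (ξ (u i)) (η (u i)) c
      linarith
    · intro a ha b hb
      rw [Metric.mem_ball] at ha hb
      have := dist_triangle_right a b c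
      linarith
  choose Λ hΛ using hall
  let Λl : StrongDual ℝ Y →ₗ[ℝ] ℝ :=
    { toFun := Λ
      map_add' := fun ξ η => tendsto_nhds_unique (hΛ (ξ + η)) ((hΛ ξ).add (hΛ η))
      map_smul' := fun c ξ => tendsto_nhds_unique (hΛ (c • ξ)) ((hΛ ξ).const_mul c) }
  have hb : ∀ ξ, ‖Λl ξ‖ ≤ R * ‖ξ‖ := by
    intro ξ
    refine le_of_tendsto (hΛ ξ).norm ?_
    filter_upwards [hR] with i hi
    rw [mul_comm]
    exact (ξ.le_opNorm _).trans (mul_le_mul_of_nonneg_left hi (norm_nonneg _))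
  -- The pointwise limit is a bounded functional on the dual, and reflexivity represents it by a
  -- vector.
  obtain ⟨y, hy⟩ := hrefl (Λl.mkContinuous R hb)
  have hyΛ : ∀ ξ : StrongDual ℝ Y, ξ y = Λ ξ := by
    intro ξ
    rw [← NormedSpace.dual_def ℝ Y y ξ, hy]
    rfl
  refine ⟨y, ?_, fun ξ => ?_⟩
  · refine NormedSpace.norm_le_dual_bound ℝ y hR0 fun ξ => ?_
    rw [hyΛ]
    exact hb ξ
  · rw [hyΛ]
    exact hΛ ξ

/-! ### Measurability and differentiability of vector functions -/

/-- Weakly measurable functions with values in a separable space are strongly measurable. -/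
theorem aestronglyMeasurable_of_forall_dual [CompleteSpace Y] [TopologicalSpace.SeparableSpace Y]
    [TopologicalSpace.SeparableSpace (StrongDual ℝ Y)] {X : Type*} [MeasurableSpace X]
    {μ : Measure X} {g : X → Y} (h : ∀ ξ : StrongDual ℝ Y, AEMeasurable (fun t => ξ (g t)) μ) :
    AEStronglyMeasurable g μ := by
  borelize Y
  have := UniformSpace.secondCountable_of_separable Y
  obtain ⟨f, hf⟩ := TopologicalSpace.exists_dense_seq (StrongDual ℝ Y)
  let J : Y → ℕ → ℝ := fun y n => f n y
  have hJc : Continuous J := continuous_pi fun n => (f n).continuous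
  have hJi : Function.Injective J := by
    intro a b hab
    rw [SeparatingDual.eq_iff_forall_dual_eq (R := ℝ)]
    have : (fun ξ : StrongDual ℝ Y => ξ a) = fun ξ => ξ b :=
      Continuous.ext_on hf (ContinuousLinearMap.apply ℝ ℝ a).continuous
        (ContinuousLinearMap.apply ℝ ℝ b).continuous (by rintro _ ⟨n, rfl⟩; exact congrFun hab n)
    exact congrFun this
  -- By the Lusin–Souslin theorem a continuous injection of a Polish space has a measurable left
  -- inverse, so measurability of the countably many coordinates `f n ∘ g` gives that of `g`.
  have hJ : MeasurableEmbedding J := hJc.measurableEmbedding hJi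
  have hm : AEMeasurable (fun t => J (g t)) μ := aemeasurable_pi_lambda _ fun n => h (f n)
  have h2 := hJ.measurable_invFun.comp_aemeasurable hm
  have h3 : (fun t => hJ.invFun (J (g t))) = g := funext fun t => hJ.leftInverse_invFun (g t)
  have h4 : AEMeasurable g μ := by
    rw [← h3]
    exact h2
  exact h4.aestronglyMeasurable

/-- Lipschitz functions with values in a separable reflexive space belong to `W^{1,∞}`. -/
theorem memW1p_top_of_lipschitz [CompleteSpace Y] [TopologicalSpace.SeparableSpace Y]
    (hrefl : Function.Surjective (NormedSpace.inclusionInDoubleDual ℝ Y)) {T : ℝ} (hT : 0 < T)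
    {L : ℝ} {y : ℝ → Y} (hy : ∀ s ∈ Icc 0 T, ∀ t ∈ Icc 0 T, ‖y t - y s‖ ≤ L * |t - s|) :
    MemW1p T ∞ y := by
  have := separableSpace_dual_of_reflexive hrefl
  have hξL : ∀ ξ : StrongDual ℝ Y, ∀ s ∈ Icc 0 T, ∀ t ∈ Icc 0 T,
      ‖ξ (y t) - ξ (y s)‖ ≤ ‖ξ‖ * L * |t - s| := by
    intro ξ s hs t ht
    rw [← map_sub, mul_assoc]
    exact (ξ.le_opNorm _).trans (mul_le_mul_of_nonneg_left (hy s hs t ht) (norm_nonneg _))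
  obtain ⟨f, hf⟩ := TopologicalSpace.exists_dense_seq (StrongDual ℝ Y)
  have hdiff : ∀ᵐ t ∂volume.restrict (Ioo 0 T), ∀ n, DifferentiableAt ℝ (fun s => f n (y s)) t :=
    ae_all_iff.2 fun n => ae_differentiableAt_of_lipschitz hT.le (hξL (f n))
  have hex : ∀ᵐ t ∂volume.restrict (Ioo 0 T), ∃ p : Y, ‖p‖ ≤ L ∧
      ∀ ξ : StrongDual ℝ Y, HasDerivAt (fun s => ξ (y s)) (ξ p) t := by
    filter_upwards [hdiff, ae_restrict_mem measurableSet_Ioo] with t ht hmem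
    have hslope : ∀ ξ : StrongDual ℝ Y, ∀ s, ξ (slope y t s) = slope (fun s => ξ (y s)) t s := by
      intro ξ s
      simp [slope_def_module]
    have hbd : ∀ᶠ s in 𝓝[≠] t, ‖slope y t s‖ ≤ L := by
      filter_upwards [self_mem_nhdsWithin, mem_nhdsWithin_of_mem_nhds (Ioo_mem_nhds hmem.1 hmem.2)]
        with s hst hs
      have hst' : 0 < |s - t| := abs_pos.2 (sub_ne_zero.2 hst)
      rw [slope_def_module, norm_smul, norm_inv, Real.norm_eq_abs, inv_mul_le_iff₀ hst', mul_comm]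
      exact hy t (Ioo_subset_Icc_self hmem) s (Ioo_subset_Icc_self hs)
    -- At a common differentiability point of the countably many `f n ∘ y`, the bounded slopes
    -- converge against a dense set, hence weakly. The limit `p` is a weak derivative, which
    -- suffices to recover `y` by testing its integral.
    obtain ⟨p, hp, hpξ⟩ := exists_weak_limit hrefl hbd hf (by
      rintro _ ⟨n, rfl⟩
      refine ⟨deriv (fun s => f n (y s)) t, ?_⟩
      simp only [hslope]
      exact (ht n).hasDerivAt.tendsto_slope)
    refine ⟨p, hp, fun ξ => ?_⟩
    rw [hasDerivAt_iff_tendsto_slope]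
    simpa only [hslope] using hpξ ξ
  have : (ae (volume.restrict (Ioo 0 T))).NeBot := ae_neBot.2 (by simp [hT])
  obtain ⟨g, hg⟩ := hex.choice
  have hm : AEStronglyMeasurable g (volume.restrict (Ioo 0 T)) := by
    refine aestronglyMeasurable_of_forall_dual fun ξ => ?_
    refine (measurable_deriv fun s => ξ (y s)).aemeasurable.congr ?_
    filter_upwards [hg] with t ht
    exact (ht.2 ξ).deriv
  have hgL : MemLp g ∞ (volume.restrict (Ioo 0 T)) :=
    memLp_top_of_bound hm L (hg.mono fun t ht => ht.1)
  refine ⟨g, hgL, fun t ht => ?_⟩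
  have h0 : (0 : ℝ) ∈ Icc 0 T := ⟨le_rfl, hT.le⟩
  have hi := intervalIntegrable_of_Ioo h0 ht (hgL.integrable le_top)
  rw [SeparatingDual.eq_iff_forall_dual_eq (R := ℝ)]
  intro ξ
  rw [map_add, ← ξ.intervalIntegral_comp_comm hi,
    ← sub_eq_integral_of_lipschitz (hξL ξ) (hg.mono fun t ht => ht.2 ξ) h0 ht, add_sub_cancel]

/-! ### Compactness of equi-Lipschitz families -/

theorem exists_subseq_tendsto_of_equilipschitz {ι : Type*} [Countable ι] {T : ℝ} (hT : 0 ≤ T)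
    {f : ℕ → ι → ℝ → ℝ} {M K : ι → ℝ} (hM : ∀ n i, ∀ t ∈ Icc 0 T, |f n i t| ≤ M i)
    (hK : ∀ n i, ∀ s ∈ Icc 0 T, ∀ t ∈ Icc 0 T, |f n i t - f n i s| ≤ K i * |t - s|) :
    ∃ σ : ℕ → ℕ, StrictMono σ ∧ ∃ g : ι → ℝ → ℝ, ∀ i, ∀ t ∈ Icc 0 T,
      Tendsto (fun n => f (σ n) i t) atTop (𝓝 (g i t)) := by
  have : Nonempty (Icc 0 T) := ⟨⟨0, le_rfl, hT⟩⟩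
  obtain ⟨d, hd⟩ := TopologicalSpace.exists_dense_seq (Icc 0 T)
  -- All values at dense times form one point of a countable product of compact intervals, so
  -- sequential compactness replaces a diagonal extraction.
  let x : ℕ → ι × ℕ → ℝ := fun n q => f n q.1 (d q.2)
  have hcpt : IsCompact (univ.pi fun q : ι × ℕ => Icc (-M q.1) (M q.1)) :=
    isCompact_univ_pi fun q => isCompact_Icc
  obtain ⟨a, -, σ, hσ, ha⟩ := hcpt.tendsto_subseq (x := x)
    fun n q _ => abs_le.1 (hM n q.1 _ (d q.2).2)
  refine ⟨σ, hσ, ?_⟩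
  have hlim : ∀ i, ∀ t : ℝ, ∃ c, t ∈ Icc 0 T → Tendsto (fun n => f (σ n) i t) atTop (𝓝 c) := by
    intro i t
    by_cases ht : t ∈ Icc 0 T
    swap
    · exact ⟨0, fun h => absurd h ht⟩
    suffices h : ∃ c, Tendsto (fun n => f (σ n) i t) atTop (𝓝 c) by
      obtain ⟨c, hc⟩ := h
      exact ⟨c, fun _ => hc⟩
    rw [← cauchy_map_iff_exists_tendsto, Metric.cauchy_iff]
    refine ⟨inferInstance, fun ε hε => ?_⟩
    obtain ⟨k, hk⟩ := hd.exists_dist_lt (⟨t, ht⟩ : Icc 0 T) (ε := ε / (4 * (|K i| + 1)))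
      (by positivity)
    rw [Subtype.dist_eq, Real.dist_eq] at hk
    have hk' : ∀ n, |f n i t - f n i (d k)| ≤ ε / 4 := by
      intro n
      refine (hK n i _ (d k).2 t ht).trans ?_
      have h1 : K i * |t - d k| ≤ (|K i| + 1) * (ε / (4 * (|K i| + 1))) :=
        mul_le_mul ((le_abs_self _).trans (by linarith)) hk.le (abs_nonneg _) (by positivity)
      refine h1.trans (le_of_eq ?_)
      field_simp
    have hc : Tendsto (fun n => f (σ n) i (d k)) atTop (𝓝 (a (i, k))) :=
      (tendsto_pi_nhds.1 ha) (i, k)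
    refine ⟨Metric.ball (a (i, k)) (ε / 2), ?_, ?_⟩
    · rw [mem_map]
      filter_upwards [hc.eventually (Metric.ball_mem_nhds _ (by positivity : 0 < ε / 4))]
        with n hn
      rw [Real.dist_eq] at hn
      rw [mem_preimage, Metric.mem_ball, Real.dist_eq]
      have h3 := abs_sub_le (f (σ n) i t) (f (σ n) i (d k)) (a (i, k))
      linarith [hk' (σ n)]
    · intro b hb c hc
      rw [Metric.mem_ball] at hb hc
      have := dist_triangle_right b c (a (i, k))
      linarith
  choose g hg using hlim
  exact ⟨g, fun i t ht => hg i t ht⟩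

/-! ### Weak-star convergence -/

section WeakStar

variable {ι : Type*} {l : Filter ι} {T L : ℝ} {g : ι → ℝ → Y} {g₀ : ℝ → Y}

theorem setIntegral_Iic_restrict_Ioo (f : ℝ → ℝ) (a : ℝ) :
    ∫ t in Iic a, f t ∂(volume.restrict (Ioo 0 T)) = ∫ t in (0 : ℝ)..(max 0 (min a T)), f t := by
  rw [intervalIntegral.integral_of_le (le_max_left _ _), restrict_Ioo_eq_restrict_Ioc,
    Measure.restrict_restrict measurableSet_Iic]
  congr 2
  ext x
  simp only [mem_inter_iff, mem_Iic, mem_Ioc, le_max_iff, le_min_iff]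
  constructor
  · rintro ⟨h1, h2, h3⟩
    exact ⟨h2, Or.inr ⟨h1, h3⟩⟩
  · rintro ⟨h1, h2 | h2⟩
    · exact absurd h1 (not_lt.2 h2)
    · exact ⟨h2.1, h1, h2.2⟩

theorem norm_setIntegral_apply_le {μ : Measure ℝ} [IsFiniteMeasure μ] {p : ℝ → Y}
    (hL : ∀ᵐ t ∂μ, ‖p t‖ ≤ L) (ξ : StrongDual ℝ Y) (S : Set ℝ) :
    ‖∫ t in S, ξ (p t) ∂μ‖ ≤ ‖ξ‖ * L * μ.real S := by
  refine norm_setIntegral_le_of_norm_le_const_ae (measure_lt_top _ _) ?_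
  filter_upwards [ae_restrict_of_ae hL] with t ht
  exact (ξ.le_opNorm _).trans (mul_le_mul_of_nonneg_left ht (norm_nonneg _))

/-- Convergence of the integrals over initial intervals implies convergence over measurable sets. -/
theorem tendsto_setIntegral_apply (hT : 0 < T)
    (hgm : ∀ᶠ i in l, AEStronglyMeasurable (g i) (volume.restrict (Ioo 0 T)))
    (hgL : ∀ᶠ i in l, ∀ᵐ t ∂volume.restrict (Ioo 0 T), ‖g i t‖ ≤ L)
    (hm₀ : AEStronglyMeasurable g₀ (volume.restrict (Ioo 0 T)))
    (hL₀ : ∀ᵐ t ∂volume.restrict (Ioo 0 T), ‖g₀ t‖ ≤ L) (ξ : StrongDual ℝ Y)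
    (h : ∀ t ∈ Icc 0 T, Tendsto (fun i => ∫ s in (0 : ℝ)..t, ξ (g i s)) l
      (𝓝 (∫ s in (0 : ℝ)..t, ξ (g₀ s)))) {S : Set ℝ} (hS : MeasurableSet S) :
    Tendsto (fun i => ∫ s in S, ξ (g i s) ∂(volume.restrict (Ioo 0 T))) l
      (𝓝 (∫ s in S, ξ (g₀ s) ∂(volume.restrict (Ioo 0 T)))) := by
  set μ := volume.restrict (Ioo 0 T) with hμ
  have hint : ∀ p : ℝ → Y, AEStronglyMeasurable p μ → (∀ᵐ t ∂μ, ‖p t‖ ≤ L) →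
      Integrable (fun t => ξ (p t)) μ := fun p h1 h2 =>
    integrable_apply_of_bound (w := fun _ => ξ) (integrable_const ξ) h1 h2
  have hi₀ := hint g₀ hm₀ hL₀
  have htot : Tendsto (fun i => ∫ s, ξ (g i s) ∂μ) l (𝓝 (∫ s, ξ (g₀ s) ∂μ)) := by
    simpa only [intervalIntegral_eq_Ioo hT.le] using h T ⟨hT.le, le_rfl⟩
  -- The half-lines `Iic a` form a π-system generating the Borel sets. On `Ioo 0 T` they amount to
  -- initial intervals, and complements are handled by the total integral `htot`.
  induction S, hS using MeasurableSpace.induction_on_inter (borel_eq_generateFrom_Iic ℝ)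
    isPiSystem_Iic with
  | empty => simpa using tendsto_const_nhds
  | basic S hS =>
    obtain ⟨a, rfl⟩ := hS
    simp only [hμ, setIntegral_Iic_restrict_Ioo]
    exact h _ ⟨le_max_left _ _, max_le hT.le (min_le_right _ _)⟩
  | compl S hS ih =>
    rw [setIntegral_compl hS hi₀]
    refine (htot.sub ih).congr' ?_
    filter_upwards [hgm, hgL] with i h1 h2
    rw [setIntegral_compl hS (hint _ h1 h2)]
  | iUnion f hd hm ih =>
    rw [integral_iUnion hm hd hi₀.integrableOn]
    have hsum : Summable fun n => ‖ξ‖ * L * μ.real (f n) :=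
      (summable_measure_toReal hm hd).mul_left _
    have := tendsto_tsum_of_dominated_convergence (𝓕 := l)
      (f := fun i n => ∫ s in f n, ξ (g i s) ∂μ) hsum ih
      (hgL.mono fun i hi n => norm_setIntegral_apply_le hi ξ (f n))
    refine this.congr' ?_
    filter_upwards [hgm, hgL] with i h1 h2
    rw [integral_iUnion hm hd (hint _ h1 h2).integrableOn]

/-- Convergence of the integrals over initial intervals implies weak-star convergence. -/
theorem tendsto_integral_apply (hT : 0 < T)
    (hgm : ∀ᶠ i in l, AEStronglyMeasurable (g i) (volume.restrict (Ioo 0 T)))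
    (hgL : ∀ᶠ i in l, ∀ᵐ t ∂volume.restrict (Ioo 0 T), ‖g i t‖ ≤ L)
    (hm₀ : AEStronglyMeasurable g₀ (volume.restrict (Ioo 0 T)))
    (hL₀ : ∀ᵐ t ∂volume.restrict (Ioo 0 T), ‖g₀ t‖ ≤ L)
    (h : ∀ ξ : StrongDual ℝ Y, ∀ t ∈ Icc 0 T, Tendsto (fun i => ∫ s in (0 : ℝ)..t, ξ (g i s)) l
      (𝓝 (∫ s in (0 : ℝ)..t, ξ (g₀ s)))) {w : ℝ → StrongDual ℝ Y}
    (hw : Integrable w (volume.restrict (Ioo 0 T))) :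
    Tendsto (fun i => ∫ t in Ioo 0 T, w t (g i t)) l (𝓝 (∫ t in Ioo 0 T, w t (g₀ t))) := by
  set μ := volume.restrict (Ioo 0 T) with hμ
  refine Integrable.induction (μ := μ) (P := fun w : ℝ → StrongDual ℝ Y =>
    Tendsto (fun i => ∫ t, w t (g i t) ∂μ) l (𝓝 (∫ t, w t (g₀ t) ∂μ))) ?_ ?_ ?_ ?_ hw
  · intro c S hS _
    have hind : ∀ p : ℝ → Y, ∫ t, (S.indicator (fun _ => c) t) (p t) ∂μ = ∫ t in S, c (p t) ∂μ := by
      intro p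
      rw [← integral_indicator hS]
      congr 1
      funext t
      by_cases ht : t ∈ S <;> simp [ht]
    simp only [hind]
    exact tendsto_setIntegral_apply hT hgm hgL hm₀ hL₀ c (h c) hS
  · intro f f' _ hf hf' h1 h2
    simp only [Pi.add_apply, add_apply]
    rw [integral_add (integrable_apply_of_bound hf hm₀ hL₀)
      (integrable_apply_of_bound hf' hm₀ hL₀)]
    refine (h1.add h2).congr' ?_
    filter_upwards [hgm, hgL] with i h3 h4
    rw [integral_add (integrable_apply_of_bound hf h3 h4) (integrable_apply_of_bound hf' h3 h4)]
  · rw [← isSeqClosed_iff_isClosed]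
    intro f fl hf hlim
    -- The error of replacing the limit weight by `f n` is uniform over all `p` bounded by `L`; this
    -- closes the class of admissible weights in `L¹`.
    have hdiff : ∀ n, ∀ p : ℝ → Y, AEStronglyMeasurable p μ → (∀ᵐ t ∂μ, ‖p t‖ ≤ L) →
        |∫ t, fl t (p t) ∂μ - ∫ t, f n t (p t) ∂μ| ≤ ‖f n - fl‖ * L := by
      intro n p h1 h2
      rw [← integral_sub (integrable_apply_of_bound (L1.integrable_coeFn _) h1 h2)
        (integrable_apply_of_bound (L1.integrable_coeFn _) h1 h2), L1.norm_eq_integral_norm,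
        ← integral_mul_const, ← Real.norm_eq_abs]
      refine norm_integral_le_of_norm_le ((L1.integrable_coeFn (f n - fl)).norm.mul_const L) ?_
      filter_upwards [h2, Lp.coeFn_sub (f n) fl] with t h3 h4
      rw [h4, Pi.sub_apply, ← sub_apply, norm_sub_rev]
      exact ((fl t - f n t).le_opNorm _).trans (mul_le_mul_of_nonneg_left h3 (norm_nonneg _))
    change Tendsto (fun i => ∫ t, fl t (g i t) ∂μ) l (𝓝 (∫ t, fl t (g₀ t) ∂μ))
    rw [Metric.tendsto_nhds]
    intro ε hε
    have hz : Tendsto (fun n => ‖f n - fl‖ * L) atTop (𝓝 0) := by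
      simpa using (tendsto_iff_norm_sub_tendsto_zero.1 hlim).mul_const L
    obtain ⟨n, hn⟩ := (hz.eventually (gt_mem_nhds (by positivity : 0 < ε / 3))).exists
    have hfn := (Metric.tendsto_nhds.1 (hf n)) (ε / 3) (by positivity)
    filter_upwards [hgm, hgL, hfn] with i h1 h2 h3
    have h4 := hdiff n _ h1 h2
    have h5 := hdiff n _ hm₀ hL₀
    rw [Real.dist_eq] at h3 ⊢
    rw [abs_le] at h4 h5
    rw [abs_lt] at h3 ⊢
    constructor <;> linarith
  · intro f f' hff' _ h1
    have heq : ∀ p : ℝ → Y, ∫ t, f t (p t) ∂μ = ∫ t, f' t (p t) ∂μ := by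
      intro p
      refine integral_congr_ae ?_
      filter_upwards [hff'] with t ht
      rw [ht]
    simpa only [heq] using h1

/-- Pointwise weak convergence of bounded families implies weak-star convergence. -/
theorem tendsto_integral_apply_of_pointwise [l.IsCountablyGenerated]
    (hgm : ∀ᶠ i in l, AEStronglyMeasurable (g i) (volume.restrict (Ioo 0 T)))
    (hgL : ∀ᶠ i in l, ∀ᵐ t ∂volume.restrict (Ioo 0 T), ‖g i t‖ ≤ L)
    (h : ∀ ξ : StrongDual ℝ Y, ∀ t ∈ Ioo 0 T, Tendsto (fun i => ξ (g i t)) l (𝓝 (ξ (g₀ t))))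
    {w : ℝ → StrongDual ℝ Y} (hw : Integrable w (volume.restrict (Ioo 0 T))) :
    Tendsto (fun i => ∫ t in Ioo 0 T, w t (g i t)) l (𝓝 (∫ t in Ioo 0 T, w t (g₀ t))) := by
  refine tendsto_integral_filter_of_dominated_convergence (fun t => ‖w t‖ * L) ?_ ?_
    (hw.norm.mul_const L) ?_
  · filter_upwards [hgm] with i hi
    exact aestronglyMeasurable_apply hw.aestronglyMeasurable hi
  · filter_upwards [hgL] with i hi
    filter_upwards [hi] with t ht
    exact ((w t).le_opNorm _).trans (mul_le_mul_of_nonneg_left ht (norm_nonneg _))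
  · filter_upwards [ae_restrict_mem measurableSet_Ioo] with t ht
    exact h (w t) t ht

/-- Pointwise weak convergence of equi-Lipschitz functions implies weak-star convergence of the
derivatives. -/
theorem tendsto_integral_apply_deriv [CompleteSpace Y] (hT : 0 < T)
    {y : ι → ℝ → Y} {y₀ : ℝ → Y} (hy : ∀ᶠ i in l, MemW1p T 1 (y i))
    (hyL : ∀ᶠ i in l, ∀ᵐ t ∂volume.restrict (Ioo 0 T), ‖deriv (y i) t‖ ≤ L)
    (hy₀ : MemW1p T 1 y₀) (hyL₀ : ∀ᵐ t ∂volume.restrict (Ioo 0 T), ‖deriv y₀ t‖ ≤ L)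
    (h : ∀ ξ : StrongDual ℝ Y, ∀ t ∈ Icc 0 T, Tendsto (fun i => ξ (y i t)) l (𝓝 (ξ (y₀ t))))
    {w : ℝ → StrongDual ℝ Y} (hw : Integrable w (volume.restrict (Ioo 0 T))) :
    Tendsto (fun i => ∫ t in Ioo 0 T, w t (deriv (y i) t)) l
      (𝓝 (∫ t in Ioo 0 T, w t (deriv y₀ t))) := by
  have h0 : (0 : ℝ) ∈ Icc 0 T := ⟨le_rfl, hT.le⟩
  have key : ∀ z : ℝ → Y, MemW1p T 1 z → ∀ ξ : StrongDual ℝ Y, ∀ t ∈ Icc 0 T,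
      ∫ s in (0 : ℝ)..t, ξ (deriv z s) = ξ (z t) - ξ (z 0) := by
    intro z hz ξ t ht
    rw [ξ.intervalIntegral_comp_comm (intervalIntegrable_of_Ioo h0 ht (hz.integrable_deriv hT)),
      ← hz.sub_eq_integral hT h0 ht, map_sub]
  refine tendsto_integral_apply hT
    (hy.mono fun i hi => (hi.integrable_deriv hT).aestronglyMeasurable) hyL
    (hy₀.integrable_deriv hT).aestronglyMeasurable hyL₀ (fun ξ t ht => ?_) hw
  rw [key y₀ hy₀ ξ t ht]
  refine ((h ξ t ht).sub (h ξ 0 h0)).congr' ?_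
  filter_upwards [hy] with i hi
  rw [key _ hi ξ t ht]

end WeakStar

/-! ### Compactness of evolutions -/

/-- An equi-Lipschitz sequence of vector functions, accompanied by an equi-Lipschitz sequence of real
functions, has a subsequence that converges weakly at all times. -/
theorem exists_subseq_weak_limit [TopologicalSpace.SeparableSpace Y]
    (hrefl : Function.Surjective (NormedSpace.inclusionInDoubleDual ℝ Y)) {T : ℝ} (hT : 0 ≤ T)
    {y : ℕ → ℝ → Y} {e : ℕ → ℝ → ℝ} {L R M N : ℝ}
    (hyL : ∀ n, ∀ s ∈ Icc 0 T, ∀ t ∈ Icc 0 T, ‖y n t - y n s‖ ≤ L * |t - s|)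
    (hyR : ∀ n, ∀ t ∈ Icc 0 T, ‖y n t‖ ≤ R)
    (heM : ∀ n, ∀ s ∈ Icc 0 T, ∀ t ∈ Icc 0 T, |e n t - e n s| ≤ M * |t - s|)
    (heN : ∀ n, ∀ t ∈ Icc 0 T, |e n t| ≤ N) :
    ∃ σ : ℕ → ℕ, StrictMono σ ∧ ∃ (z : ℝ → Y) (E : ℝ → ℝ),
      (∀ t ∈ Icc 0 T, WeakTendsto (fun n => y (σ n) t) (z t)) ∧
      (∀ t ∈ Icc 0 T, Tendsto (fun n => e (σ n) t) atTop (𝓝 (E t))) := by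
  have := separableSpace_dual_of_reflexive hrefl
  obtain ⟨f, hf⟩ := TopologicalSpace.exists_dense_seq (StrongDual ℝ Y)
  -- The index `none` carries the real functions `e n`, and `some k` carries `f k ∘ y n`, so one
  -- extraction handles both.
  obtain ⟨σ, hσ, g, hg⟩ := exists_subseq_tendsto_of_equilipschitz (ι := Option ℕ) hT
    (f := fun n i t => i.elim (e n t) fun k => f k (y n t))
    (M := fun i => i.elim N fun k => ‖f k‖ * R) (K := fun i => i.elim M fun k => ‖f k‖ * L)
    (by
      rintro n (_ | k) t ht
      · exact heN n t ht
      · exact ((f k).le_opNorm _).trans (mul_le_mul_of_nonneg_left (hyR n t ht) (norm_nonneg _)))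
    (by
      rintro n (_ | k) s hs t ht
      · exact heM n s hs t ht
      · change |f k (y n t) - f k (y n s)| ≤ ‖f k‖ * L * |t - s|
        rw [← map_sub, mul_assoc]
        exact ((f k).le_opNorm _).trans
          (mul_le_mul_of_nonneg_left (hyL n s hs t ht) (norm_nonneg _)))
  have hz : ∀ t : ℝ, ∃ z : Y, t ∈ Icc 0 T → WeakTendsto (fun n => y (σ n) t) z := by
    intro t
    by_cases ht : t ∈ Icc 0 T
    · obtain ⟨z, -, hz⟩ := exists_weak_limit hrefl (l := atTop) (u := fun n => y (σ n) t)
        (Eventually.of_forall fun n => hyR (σ n) t ht) hf (by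
          rintro _ ⟨k, rfl⟩
          exact ⟨_, hg (some k) t ht⟩)
      exact ⟨z, fun _ => hz⟩
    · exact ⟨0, fun h => absurd h ht⟩
  choose z hz using hz
  exact ⟨σ, hσ, z, g none, fun t ht => hz t ht, fun t ht => hg none t ht⟩

/-- Weak lower semicontinuity of the norm, used to transfer the common Lipschitz constant to the
weak limit. -/
theorem norm_sub_le_of_weakTendsto {u v : ℕ → Y} {x z : Y} {C : ℝ} (hu : WeakTendsto u x)
    (hv : WeakTendsto v z) (h : ∀ n, ‖u n - v n‖ ≤ C) : ‖x - z‖ ≤ C := by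
  refine NormedSpace.norm_le_dual_bound ℝ _ ((norm_nonneg _).trans (h 0)) fun ξ => ?_
  rw [map_sub]
  refine le_of_tendsto ((hu ξ).sub (hv ξ)).norm (Eventually.of_forall fun n => ?_)
  rw [← map_sub, mul_comm]
  exact (ξ.le_opNorm _).trans (mul_le_mul_of_nonneg_left (h n) (norm_nonneg _))

theorem WeakTendsto.tendsto_apply {u : ℕ → Y} {x : Y} {R : ℝ} (hu : WeakTendsto u x)
    (hR : ∀ n, ‖u n‖ ≤ R) {η : ℕ → StrongDual ℝ Y} {ξ : StrongDual ℝ Y}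
    (hη : Tendsto η atTop (𝓝 ξ)) : Tendsto (fun n => η n (u n)) atTop (𝓝 (ξ x)) := by
  have h1 : Tendsto (fun n => (η n - ξ) (u n)) atTop (𝓝 0) := by
    refine squeeze_zero_norm (a := fun n => ‖η n - ξ‖ * R) (fun n => ?_) ?_
    · exact ((η n - ξ).le_opNorm _).trans (mul_le_mul_of_nonneg_left (hR n) (norm_nonneg _))
    · simpa using (tendsto_iff_norm_sub_tendsto_zero.1 hη).mul_const R
  simpa using h1.add (hu ξ)

theorem WeakTendsto.sub {u v : ℕ → Y} {x z : Y} (hu : WeakTendsto u x) (hv : WeakTendsto v z) :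
    WeakTendsto (fun n => u n - v n) (x - z) := fun ξ => by
  simpa only [map_sub] using (hu ξ).sub (hv ξ)

theorem weakTendsto_of_tendsto {u : ℕ → Y} {x : Y} (hu : Tendsto u atTop (𝓝 x)) :
    WeakTendsto u x := fun ξ => (ξ.continuous.tendsto x).comp hu

/-- Uniform coercivity passes to the Mosco limit. -/
theorem MoscoTendsto.coercive {Ψ : ℕ → Y → EReal} {ψ : Y → EReal} (h : MoscoTendsto Ψ ψ)
    {A : Y →L[ℝ] StrongDual ℝ Y} {α : ℝ}
    (hcoerc : ∀ n, ∀ y ∈ dom (Ψ n) - dom (Ψ n), α / 2 * ‖y‖ ^ 2 ≤ phi A y) :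
    ∀ y ∈ dom ψ - dom ψ, α / 2 * ‖y‖ ^ 2 ≤ phi A y := by
  rintro _ ⟨a, ha, b, hb, rfl⟩
  obtain ⟨u, hu, hua⟩ := (h a).2
  obtain ⟨v, hv, hvb⟩ := (h b).2
  -- A limsup below `∞` puts the recovery sequence eventually in `dom (Ψ n)`, and `φ` is continuous
  -- along its strong limit.
  have hu' : ∀ᶠ n in atTop, Ψ n (u n) < ⊤ := eventually_lt_of_limsup_lt (hua ▸ ha)
  have hv' : ∀ᶠ n in atTop, Ψ n (v n) < ⊤ := eventually_lt_of_limsup_lt (hvb ▸ hb)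
  have hlim := hu.sub hv
  refine le_of_tendsto_of_tendsto ((hlim.norm.pow 2).const_mul (α / 2))
    ((continuous_phi.tendsto _).comp hlim) ?_
  filter_upwards [hu', hv'] with n h1 h2
  exact hcoerc n _ ⟨u n, h1, v n, h2, rfl⟩

/-! ### The energy balance -/

section Energy

variable {T : ℝ} {ψ : Y → EReal} {A : Y →L[ℝ] StrongDual ℝ Y} {ℓ : ℝ → StrongDual ℝ Y} {y : ℝ → Y}

theorem integral_power_eq [CompleteSpace Y] (hT : 0 < T) (hA : ∀ x y, A x y = A y x)
    (hℓ : ContinuousOn ℓ (Icc 0 T)) (hy : MemW1p T 1 y) {L : ℝ} (hL0 : 0 ≤ L)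
    (hL : ∀ s ∈ Icc 0 T, ∀ t ∈ Icc 0 T, ‖y t - y s‖ ≤ L * |t - s|) :
    ∫ t in (0 : ℝ)..T, (ℓ t - A (y t)) (deriv y t) =
      (∫ t in Ioo 0 T, ℓ t (deriv y t)) - (phi A (y T) - phi A (y 0)) := by
  have h0 : (0 : ℝ) ∈ Icc 0 T := ⟨le_rfl, hT.le⟩
  have h1 : T ∈ Icc 0 T := ⟨hT.le, le_rfl⟩
  have hi := hy.integrable_deriv hT
  have hder : ∀ᵐ t ∂volume.restrict (Ioo 0 T),
      HasDerivAt (fun s => phi A (y s)) (A (y t) (deriv y t)) t := by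
    filter_upwards [hy.ae_hasDerivAt hT] with t ht
    exact hasDerivAt_phi hA ht
  rw [sub_eq_integral_of_lipschitz (phi_comp_lipschitz hA hT.le hL0 hL) hder h0 h1,
    ← intervalIntegral_eq_Ioo hT.le, ← intervalIntegral.integral_sub]
  · simp only [sub_apply]
  · exact intervalIntegrable_of_Ioo h0 h1 (integrable_apply_of_continuousOn hℓ hi)
  · exact intervalIntegrable_of_Ioo h0 h1 (integrable_apply_of_continuousOn
      (A.continuous.comp_continuousOn (hy.continuousOn hT)) hi)

theorem abs_integral_power_le {ξ : ℝ → StrongDual ℝ Y} {p : ℝ → Y} {C L : ℝ}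
    (hC : ∀ t ∈ Icc 0 T, ‖ξ t‖ ≤ C) (hL : ∀ᵐ t ∂volume.restrict (Ioo 0 T), ‖p t‖ ≤ L)
    {s t : ℝ} (hs : s ∈ Icc 0 T) (ht : t ∈ Icc 0 T) :
    ‖∫ x in s..t, ξ x (p x)‖ ≤ C * L * |t - s| := by
  refine intervalIntegral.norm_integral_le_of_norm_le_const_ae ?_
  refine (ae_restrict_iff' measurableSet_uIoc).1 (ae_restrict_uIoc hs ht ?_)
  filter_upwards [hL, ae_restrict_mem measurableSet_Ioo] with x hx hmem
  have hCx := hC x (Ioo_subset_Icc_self hmem)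
  exact ((ξ x).le_opNorm _).trans (mul_le_mul hCx hx (norm_nonneg _) ((norm_nonneg _).trans hCx))

theorem integral_power_sub [CompleteSpace Y] (hT : 0 < T) (hℓ : ContinuousOn ℓ (Icc 0 T))
    (hy : MemW1p T 1 y) {s t : ℝ} (hs : s ∈ Icc 0 T) (ht : t ∈ Icc 0 T) :
    (∫ x in (0 : ℝ)..t, (ℓ x - A (y x)) (deriv y x)) -
      ∫ x in (0 : ℝ)..s, (ℓ x - A (y x)) (deriv y x) =
      ∫ x in s..t, (ℓ x - A (y x)) (deriv y x) := by
  have h0 : (0 : ℝ) ∈ Icc 0 T := ⟨le_rfl, hT.le⟩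
  have hi := integrable_apply_of_continuousOn
    (hℓ.sub (A.continuous.comp_continuousOn (hy.continuousOn hT))) (hy.integrable_deriv hT)
  exact intervalIntegral.integral_interval_sub_left (intervalIntegrable_of_Ioo h0 ht hi)
    (intervalIntegrable_of_Ioo h0 hs hi)

/-- A stable Lipschitz function is an evolution if a function that controls the dissipation of its
increments does not exceed the total work. -/
theorem isEvolution_of_dissipation_le [CompleteSpace Y] (hT : 0 < T) (hψ : IsDissipation ψ)
    (hℓ : ContinuousOn ℓ (Icc 0 T)) (hy : MemW1p T 1 y) {L : ℝ}
    (hL : ∀ᵐ t ∂volume.restrict (Ioo 0 T), ‖deriv y t‖ ≤ L)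
    (hstable : ∀ t ∈ Icc 0 T, ∀ v, (((ℓ t - A (y t)) v : ℝ) : EReal) ≤ ψ v) {E : ℝ → ℝ} {M : ℝ}
    (hE : ∀ s ∈ Icc 0 T, ∀ t ∈ Icc 0 T, |E t - E s| ≤ M * |t - s|) (hE0 : E 0 = 0)
    (hdiss : ∀ s ∈ Icc 0 T, ∀ t ∈ Icc 0 T, s ≤ t → ψ (y t - y s) ≤ ((E t - E s : ℝ) : EReal))
    (hET : E T ≤ ∫ t in (0 : ℝ)..T, (ℓ t - A (y t)) (deriv y t)) :
    IsEvolution T ψ A ℓ y := by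
  have h0 : (0 : ℝ) ∈ Icc 0 T := ⟨le_rfl, hT.le⟩
  have h1 : T ∈ Icc 0 T := ⟨hT.le, le_rfl⟩
  have hξ : ContinuousOn (fun t => ℓ t - A (y t)) (Icc 0 T) :=
    hℓ.sub (A.continuous.comp_continuousOn (hy.continuousOn hT))
  obtain ⟨C, hC⟩ := isCompact_Icc.exists_bound_of_continuousOn hξ
  set r : ℝ → ℝ := fun t => ∫ x in (0 : ℝ)..t, (ℓ x - A (y x)) (deriv y x) with hr
  have hr0 : r 0 = 0 := by simp [hr]
  have hrL : ∀ s ∈ Icc 0 T, ∀ t ∈ Icc 0 T, ‖r t - r s‖ ≤ C * L * |t - s| := by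
    intro s hs t ht
    rw [hr]
    simp only
    rw [integral_power_sub hT hℓ hy hs ht]
    exact abs_integral_power_le hC hL hs ht
  have hrd : ∀ᵐ t ∂volume.restrict (Ioo 0 T),
      HasDerivAt r ((ℓ t - A (y t)) (deriv y t)) t :=
    ae_hasDerivAt_of_eq_add_integral hT
      (integrable_apply_of_continuousOn hξ (hy.integrable_deriv hT))
      fun t ht => by rw [hr0, zero_add]
  have hEd := ae_differentiableAt_of_lipschitz hT.le hE
  have hdL : ∀ s ∈ Icc 0 T, ∀ t ∈ Icc 0 T,
      ‖(E t - r t) - (E s - r s)‖ ≤ (M + C * L) * |t - s| := by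
    intro s hs t ht
    rw [sub_sub_sub_comm, add_mul]
    exact (norm_sub_le _ _).trans (add_le_add (hE s hs t ht) (hrL s hs t ht))
  have hdd : ∀ᵐ t ∂volume.restrict (Ioo 0 T),
      HasDerivAt (fun t => E t - r t) (deriv E t - (ℓ t - A (y t)) (deriv y t)) t := by
    filter_upwards [hEd, hrd] with t h2 h3
    exact h2.hasDerivAt.sub h3
  have hdn : ∀ᵐ t ∂volume.restrict (Ioo 0 T),
      0 ≤ deriv E t - (ℓ t - A (y t)) (deriv y t) := by
    filter_upwards [hEd, hy.ae_hasDerivAt hT, ae_restrict_mem measurableSet_Ioo] with t h2 h3 ht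
    have htI := Ioo_subset_Icc_self ht
    have hsub : 𝓝[>] t ≤ 𝓝[≠] t := nhdsWithin_mono _ fun s hs => (mem_Ioi.1 hs).ne'
    have h4 := h2.hasDerivAt.tendsto_slope.mono_left hsub
    have h5 := ((ℓ t - A (y t)).continuous.tendsto _).comp (h3.tendsto_slope.mono_left hsub)
    rw [sub_nonneg]
    refine le_of_tendsto_of_tendsto h5 h4 ?_
    filter_upwards [self_mem_nhdsWithin, mem_nhdsWithin_of_mem_nhds (Ioo_mem_nhds ht.1 ht.2)]
      with s hst hs
    have hst' : 0 < s - t := sub_pos.2 hst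
    -- Stability of the state at `t`, tested with the increment to `s`, bounds the work rate by the
    -- growth of `E`.
    have h6 := (hstable t htI (y s - y t)).trans
      (hdiss t htI s (Ioo_subset_Icc_self hs) (le_of_lt hst))
    rw [EReal.coe_le_coe_iff] at h6
    simp only [Function.comp_apply]
    rw [slope_def_module, slope_def_module, map_smul, smul_eq_mul, smul_eq_mul]
    exact mul_le_mul_of_nonneg_left h6 (inv_nonneg.2 hst'.le)
  -- `E - r` is nondecreasing, starts at `0` and ends at a nonpositive value, hence vanishes
  -- throughout.
  have heq : ∀ t ∈ Icc 0 T, E t = r t := by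
    intro t ht
    have h2 := le_of_ae_deriv_nonneg hdL hdd hdn h0 ht ht.1
    have h3 := le_of_ae_deriv_nonneg hdL hdd hdn ht h1 ht.2
    rw [hE0, hr0] at h2
    have h4 : E T ≤ r T := hET
    linarith
  refine ⟨hy, hstable, ?_⟩
  filter_upwards [hrd, hy.ae_hasDerivAt hT, ae_restrict_mem measurableSet_Ioo] with t h2 h3 ht
  have htI := Ioo_subset_Icc_self ht
  refine le_antisymm ?_ (hstable t htI _)
  have hsub : 𝓝[>] t ≤ 𝓝[≠] t := nhdsWithin_mono _ fun s hs => (mem_Ioi.1 hs).ne'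
  -- The paired slopes of `y` and `r` lie in the closed epigraph of `ψ`; their limit yields the
  -- missing half of the flow rule.
  have h4 := (h3.tendsto_slope.mono_left hsub).prodMk_nhds (h2.tendsto_slope.mono_left hsub)
  refine hψ.isClosed_epigraph.mem_of_tendsto h4 ?_
  filter_upwards [self_mem_nhdsWithin, mem_nhdsWithin_of_mem_nhds (Ioo_mem_nhds ht.1 ht.2)]
    with s hst hs
  have hst' : 0 < s - t := sub_pos.2 hst
  have hsI := Ioo_subset_Icc_self hs
  have h6 := hdiss t htI s hsI (le_of_lt hst)
  rw [heq t htI, heq s hsI] at h6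
  change ψ (slope y t s) ≤ ((slope r t s : ℝ) : EReal)
  rw [slope_def_module, slope_def_module, hψ.homogeneous _ _ (inv_pos.2 hst'), smul_eq_mul,
    EReal.coe_mul]
  exact mul_le_mul_of_nonneg_left h6 (EReal.coe_nonneg.2 (inv_nonneg.2 hst'.le))

end Energy

/-! ### Passage to the limit -/

section Limit

variable {T : ℝ} {ψ : Y → EReal} {Ψ : ℕ → Y → EReal} {A : Y →L[ℝ] StrongDual ℝ Y}
  {ℓ : ℝ → StrongDual ℝ Y} {Λ : ℕ → ℝ → StrongDual ℝ Y} {y : ℝ → Y} {z : ℕ → ℝ → Y}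

/-- Stability passes to the Mosco limit. -/
theorem MoscoTendsto.stable (hmosco : MoscoTendsto Ψ ψ) (hA : ∀ x y, A x y = A y x)
    {η : ℕ → StrongDual ℝ Y} {ξ : StrongDual ℝ Y} (hη : Tendsto η atTop (𝓝 ξ)) {u : ℕ → Y} {x : Y}
    (hu : WeakTendsto u x) {R : ℝ} (hR : ∀ n, ‖u n‖ ≤ R)
    (h : ∀ n, ∀ v, (((η n - A (u n)) v : ℝ) : EReal) ≤ Ψ n v) (v : Y) :
    (((ξ - A x) v : ℝ) : EReal) ≤ ψ v := by
  obtain ⟨w, hw, hwv⟩ := (hmosco v).2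
  have h1 : Tendsto (fun n => η n (w n)) atTop (𝓝 (ξ v)) :=
    (isBoundedBilinearMap_apply.continuous.tendsto (ξ, v)).comp (hη.prodMk_nhds hw)
  have h2 : Tendsto (fun n => A (w n) (u n)) atTop (𝓝 (A v x)) :=
    hu.tendsto_apply hR ((A.continuous.tendsto v).comp hw)
  have h3 : Tendsto (fun n => (((η n - A (u n)) (w n) : ℝ) : EReal)) atTop
      (𝓝 (((ξ - A x) v : ℝ) : EReal)) := by
    refine (continuous_coe_real_ereal.tendsto _).comp ?_
    -- Symmetry moves `A` onto the strongly convergent `w n`, leaving a pairing of strong with weak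
    -- convergence.
    simp only [sub_apply, hA x v, hA (u _) (w _)]
    exact h1.sub h2
  rw [hwv, ← h3.limsup_eq]
  exact limsup_le_limsup (Eventually.of_forall fun n => h n (w n))

/-- Strongly convergent loads and weakly convergent rates have convergent powers. -/
theorem tendsto_integral_load [CompleteSpace Y] (hT : 0 < T) {L C : ℝ} (hL0 : 0 ≤ L)
    (hΛc : ∀ n, ContinuousOn (Λ n) (Icc 0 T)) (hℓc : ContinuousOn ℓ (Icc 0 T))
    (hΛ : ∀ t ∈ Icc 0 T, Tendsto (fun n => Λ n t) atTop (𝓝 (ℓ t)))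
    (hC : ∀ n, ∀ t ∈ Icc 0 T, ‖Λ n t - ℓ t‖ ≤ C) (hz : ∀ n, MemW1p T 1 (z n))
    (hzL : ∀ n, ∀ᵐ t ∂volume.restrict (Ioo 0 T), ‖deriv (z n) t‖ ≤ L) (hy : MemW1p T 1 y)
    (hyL : ∀ᵐ t ∂volume.restrict (Ioo 0 T), ‖deriv y t‖ ≤ L)
    (hweak : ∀ t ∈ Icc 0 T, WeakTendsto (fun n => z n t) (y t)) :
    Tendsto (fun n => ∫ t in Ioo 0 T, Λ n t (deriv (z n) t)) atTop
      (𝓝 (∫ t in Ioo 0 T, ℓ t (deriv y t))) := by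
  have hsub : Ioo 0 T ⊆ Icc 0 T := Ioo_subset_Icc_self
  have hℓi : Integrable ℓ (volume.restrict (Ioo 0 T)) :=
    (hℓc.integrableOn_Icc).mono_set hsub
  -- With the load frozen at `ℓ` the weak-star convergence of the rates applies; the change of load
  -- is then controlled by dominated convergence.
  have h1 := tendsto_integral_apply_deriv (l := atTop) hT (Eventually.of_forall hz)
    (Eventually.of_forall hzL) hy hyL (fun ξ t ht => hweak t ht ξ) hℓi
  have h2 : Tendsto (fun n => ∫ t in Ioo 0 T, ‖Λ n t - ℓ t‖ * L) atTop (𝓝 0) := by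
    have : Tendsto (fun n => ∫ t in Ioo 0 T, ‖Λ n t - ℓ t‖ * L) atTop
        (𝓝 (∫ t in Ioo 0 T, (0 : ℝ))) := by
      refine tendsto_integral_filter_of_dominated_convergence (fun _ => C * L)
        (Eventually.of_forall fun n => ?_) (Eventually.of_forall fun n => ?_)
        (integrable_const _) ?_
      · exact ((((hΛc n).sub hℓc).norm.mul continuousOn_const).mono hsub).aestronglyMeasurable
          measurableSet_Ioo
      · filter_upwards [ae_restrict_mem measurableSet_Ioo] with t ht
        rw [norm_mul, norm_norm, Real.norm_of_nonneg hL0]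
        exact mul_le_mul_of_nonneg_right (hC n t (hsub ht)) hL0
      · filter_upwards [ae_restrict_mem measurableSet_Ioo] with t ht
        simpa using (tendsto_iff_norm_sub_tendsto_zero.1 (hΛ t (hsub ht))).mul_const L
    simpa using this
  have h3 : Tendsto (fun n => (∫ t in Ioo 0 T, Λ n t (deriv (z n) t)) -
      ∫ t in Ioo 0 T, ℓ t (deriv (z n) t)) atTop (𝓝 0) := by
    refine squeeze_zero_norm (fun n => ?_) h2
    have hi := (hz n).integrable_deriv hT
    rw [← integral_sub (integrable_apply_of_continuousOn (hΛc n) hi)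
      (integrable_apply_of_continuousOn hℓc hi)]
    refine norm_integral_le_of_norm_le ?_ ?_
    · exact (((((hΛc n).sub hℓc).norm.mul continuousOn_const)).integrableOn_Icc).mono_set hsub
    · filter_upwards [hzL n] with t ht
      rw [← sub_apply]
      exact ((Λ n t - ℓ t).le_opNorm _).trans (mul_le_mul_of_nonneg_left ht (norm_nonneg _))
  simpa using h3.add h1

/-- Limits of evolutions along Mosco convergent dissipations are evolutions. -/
theorem MoscoTendsto.isEvolution [CompleteSpace Y] (hmosco : MoscoTendsto Ψ ψ) (hT : 0 < T)
    (hA : ∀ x y, A x y = A y x) (hψ : IsDissipation ψ) (hΨ : ∀ n, IsDissipation (Ψ n))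
    (hcoerc : ∀ n, ∀ v ∈ dom (Ψ n) - dom (Ψ n), 0 ≤ phi A v) {L R C M : ℝ} (hL0 : 0 ≤ L)
    (hΛc : ∀ n, ContinuousOn (Λ n) (Icc 0 T)) (hℓc : ContinuousOn ℓ (Icc 0 T))
    (hΛ : ∀ t ∈ Icc 0 T, Tendsto (fun n => Λ n t) atTop (𝓝 (ℓ t)))
    (hC : ∀ n, ∀ t ∈ Icc 0 T, ‖Λ n t - ℓ t‖ ≤ C)
    (hz : ∀ n, IsEvolution T (Ψ n) A (Λ n) (z n))
    (hzL : ∀ n, ∀ᵐ t ∂volume.restrict (Ioo 0 T), ‖deriv (z n) t‖ ≤ L)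
    (hzR : ∀ n, ∀ t ∈ Icc 0 T, ‖z n t‖ ≤ R) (hy : MemW1p T 1 y)
    (hyL : ∀ s ∈ Icc 0 T, ∀ t ∈ Icc 0 T, ‖y t - y s‖ ≤ L * |t - s|)
    (hweak : ∀ t ∈ Icc 0 T, WeakTendsto (fun n => z n t) (y t))
    (hinit : Tendsto (fun n => z n 0) atTop (𝓝 (y 0))) {E : ℝ → ℝ}
    (hEM : ∀ n, ∀ s ∈ Icc 0 T, ∀ t ∈ Icc 0 T,
      |∫ x in s..t, (Λ n x - A (z n x)) (deriv (z n) x)| ≤ M * |t - s|)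
    (hE : ∀ t ∈ Icc 0 T, Tendsto
      (fun n => ∫ x in (0 : ℝ)..t, (Λ n x - A (z n x)) (deriv (z n) x)) atTop (𝓝 (E t))) :
    IsEvolution T ψ A ℓ y := by
  have h0 : (0 : ℝ) ∈ Icc 0 T := ⟨le_rfl, hT.le⟩
  have h1 : T ∈ Icc 0 T := ⟨hT.le, le_rfl⟩
  have hyd : ∀ᵐ t ∂volume.restrict (Ioo 0 T), ‖deriv y t‖ ≤ L := by
    filter_upwards [ae_restrict_mem measurableSet_Ioo] with t ht
    exact norm_deriv_le_of_forall_norm_sub_le hL0 hyL ht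
  have hEsub : ∀ s ∈ Icc 0 T, ∀ t ∈ Icc 0 T, Tendsto
      (fun n => ∫ x in s..t, (Λ n x - A (z n x)) (deriv (z n) x)) atTop (𝓝 (E t - E s)) := by
    intro s hs t ht
    refine ((hE t ht).sub (hE s hs)).congr fun n => ?_
    exact integral_power_sub hT (hΛc n) (hz n).mem hs ht
  have hdiss : ∀ s ∈ Icc 0 T, ∀ t ∈ Icc 0 T, s ≤ t →
      ψ (y t - y s) ≤ ((E t - E s : ℝ) : EReal) := by
    intro s hs t ht hst
    refine ((hmosco (y t - y s)).1 _ ((hweak t ht).sub (hweak s hs))).trans ?_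
    rw [← ((continuous_coe_real_ereal.tendsto _).comp (hEsub s hs t ht)).liminf_eq]
    exact liminf_le_liminf (Eventually.of_forall fun n =>
      (hz n).dissipation_sub_le hT (hΨ n) (hΛc n) hs ht hst)
  refine isEvolution_of_dissipation_le hT hψ hℓc hy hyd (fun t ht v => ?_) (E := E) (M := M)
    (fun s hs t ht => ?_) ?_ hdiss ?_
  · exact hmosco.stable hA (hΛ t ht) (hweak t ht) (fun n => hzR n t ht)
      (fun n => (hz n).stable t ht) v
  · exact le_of_tendsto (hEsub s hs t ht).abs (Eventually.of_forall fun n => hEM n s hs t ht)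
  · exact tendsto_nhds_unique (hE 0 h0) (by simp)
  · have hzLip : ∀ n, ∀ s ∈ Icc 0 T, ∀ t ∈ Icc 0 T, ‖z n t - z n s‖ ≤ L * |t - s| :=
      fun n s hs t ht => (hz n).mem.norm_sub_le hT (hzL n) hs ht
    have hw : y T - y 0 ∈ dom ψ :=
      (hdiss 0 h0 T h1 hT.le).trans_lt (EReal.coe_lt_top _)
    obtain ⟨w, hwlim, hws⟩ := (hmosco (y T - y 0)).2
    have hw' : ∀ᶠ n in atTop, Ψ n (w n) < ⊤ := eventually_lt_of_limsup_lt (hws ▸ hw)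
    have hload := tendsto_integral_load hT hL0 hΛc hℓc hΛ hC (fun n => (hz n).mem) hzL hy hyd hweak
    have hphi0 := (continuous_phi (A := A).tendsto _).comp hinit
    have hphiw := (continuous_phi (A := A).tendsto _).comp hwlim
    have hcross1 : Tendsto (fun n => A (w n) (z n T - z n 0)) atTop
        (𝓝 (A (y T - y 0) (y T - y 0))) :=
      ((hweak T h1).sub (hweak 0 h0)).tendsto_apply (R := R + R)
        (fun n => (norm_sub_le _ _).trans (add_le_add (hzR n T h1) (hzR n 0 h0)))
        ((A.continuous.tendsto _).comp hwlim)
    have hcross2 : Tendsto (fun n => A (z n 0) (z n T)) atTop (𝓝 (A (y 0) (y T))) :=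
      (hweak T h1).tendsto_apply (fun n => hzR n T h1) ((A.continuous.tendsto _).comp hinit)
    -- This combination is the upper bound for the work of `z n` obtained by expanding `0 ≤ φ(z n T
    -- - z n 0 - w n)`. Each term converges although `φ(z n T)` itself need not, and the limit is
    -- exactly the work of `y`.
    have hlim := ((hload.sub hcross1).add hphiw).sub hcross2 |>.add (hphi0.add hphi0)
    rw [integral_power_eq hT hA hℓc hy hL0 hyL]
    refine (le_of_tendsto_of_tendsto (hE T h1) hlim ?_).trans (le_of_eq ?_)
    · filter_upwards [hw'] with n hn
      rw [integral_power_eq hT hA (hΛc n) (hz n).mem hL0 (hzLip n)]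
      have h2 := hcoerc n _ ⟨z n T - z n 0, (hz n).sub_mem_dom hT (hΨ n) (hΛc n) h0 h1 hT.le,
        w n, hn, rfl⟩
      simp only [phi_sub hA, Function.comp_apply] at h2 ⊢
      rw [hA (z n T - z n 0) (w n), hA (z n T) (z n 0)] at h2
      linarith
    · simp only [phi_sub hA]
      have h3 : A (y T - y 0) (y T - y 0) = 2 * phi A (y T - y 0) := by rw [phi]; ring
      rw [h3, phi_sub hA, hA (y 0) (y T)]
      ring

end Limit

/-- Along every sequence of parameters tending to zero, solutions of the approximating problems
subconverge weakly at all times to an evolution. -/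
theorem exists_subseq_tendsto_evolution [CompleteSpace Y] [TopologicalSpace.SeparableSpace Y]
    (hrefl : Function.Surjective (NormedSpace.inclusionInDoubleDual ℝ Y)) {T : ℝ} (hT : 0 < T)
    {ψ : Y → EReal} (hψ : IsDissipation ψ) {A : Y →L[ℝ] StrongDual ℝ Y}
    (hA : ∀ x y, A x y = A y x) {Ψ : ℕ → Y → EReal} (hΨ : ∀ n, IsDissipation (Ψ n))
    (hmosco : ∀ σ : ℕ → ℕ, StrictMono σ → MoscoTendsto (fun n => Ψ (σ n)) ψ)
    {α : ℝ} (hα : 0 < α)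
    (hcoerc : ∀ n, ∀ v ∈ dom (Ψ n) - dom (Ψ n), α / 2 * ‖v‖ ^ 2 ≤ phi A v)
    {ℓ : ℝ → StrongDual ℝ Y} {Λ : ℕ → ℝ → StrongDual ℝ Y} {K : ℝ≥0}
    (hΛ : ∀ t ∈ Icc 0 T, Tendsto (fun n => Λ n t) atTop (𝓝 (ℓ t)))
    (hΛK : ∀ n, LipschitzOnWith K (Λ n) (Icc 0 T)) (hℓK : LipschitzOnWith K ℓ (Icc 0 T))
    {z : ℕ → ℝ → Y} (hz : ∀ n, IsEvolution T (Ψ n) A (Λ n) (z n)) {y₀ : Y}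
    (hinit : Tendsto (fun n => z n 0) atTop (𝓝 y₀)) :
    ∃ σ : ℕ → ℕ, StrictMono σ ∧ ∃ y : ℝ → Y, IsEvolution T ψ A ℓ y ∧ y 0 = y₀ ∧
      ∀ t ∈ Icc 0 T, WeakTendsto (fun n => z (σ n) t) (y t) := by
  have h0 : (0 : ℝ) ∈ Icc 0 T := ⟨le_rfl, hT.le⟩
  have hL0 : 0 ≤ K / α := by positivity
  have hzd := fun n => (hz n).norm_deriv_le hT (hΨ n) hα (hcoerc n) (hΛK n)
  have hzL := fun n => (hz n).lipschitz hT (hΨ n) hα (hcoerc n) (hΛK n)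
  obtain ⟨R₀, hR₀⟩ := hinit.norm.bddAbove_range
  have hzR : ∀ n, ∀ t ∈ Icc 0 T, ‖z n t‖ ≤ R₀ + K / α * T := fun n t ht =>
    (norm_le_of_lipschitz hT.le hL0 (hzL n) ht).trans
      (add_le_add (hR₀ (mem_range_self n)) le_rfl)
  obtain ⟨C₀, hC₀⟩ := (tendsto_iff_norm_sub_tendsto_zero.1 (hΛ 0 h0)).bddAbove_range
  have hC : ∀ n, ∀ t ∈ Icc 0 T, ‖Λ n t - ℓ t‖ ≤ C₀ + (K + K) * T := by
    intro n t ht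
    have h1 := hC₀ (mem_range_self n)
    have h2 := (hΛK n).dist_le_mul t ht 0 h0
    have h3 := hℓK.dist_le_mul t ht 0 h0
    rw [dist_eq_norm, Real.dist_eq, sub_zero, abs_of_nonneg ht.1] at h2 h3
    have h4 : (K : ℝ) * t ≤ K * T := mul_le_mul_of_nonneg_left ht.2 K.coe_nonneg
    have h5 : Λ n t - ℓ t = (Λ n 0 - ℓ 0) + ((Λ n t - Λ n 0) - (ℓ t - ℓ 0)) := by abel
    rw [h5]
    have h6 := norm_add_le (Λ n 0 - ℓ 0) ((Λ n t - Λ n 0) - (ℓ t - ℓ 0))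
    have h7 := norm_sub_le (Λ n t - Λ n 0) (ℓ t - ℓ 0)
    have h1' : ‖Λ n 0 - ℓ 0‖ ≤ C₀ := h1
    linarith
  obtain ⟨B, hB⟩ := isCompact_Icc.exists_bound_of_continuousOn hℓK.continuousOn
  set D : ℝ := C₀ + (K + K) * T + B + ‖A‖ * (R₀ + K / α * T) with hD
  have hforce : ∀ n, ∀ t ∈ Icc 0 T, ‖Λ n t - A (z n t)‖ ≤ D := by
    intro n t ht
    have h1 := norm_sub_le (Λ n t) (A (z n t))
    have h2 := norm_le_norm_add_norm_sub (ℓ t) (Λ n t)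
    rw [norm_sub_rev] at h2
    have h3 := (A.le_opNorm (z n t)).trans
      (mul_le_mul_of_nonneg_left (hzR n t ht) (norm_nonneg _))
    linarith [hC n t ht, hB t ht]
  have hpow : ∀ n, ∀ s ∈ Icc 0 T, ∀ t ∈ Icc 0 T,
      |∫ x in s..t, (Λ n x - A (z n x)) (deriv (z n) x)| ≤ D * (K / α) * |t - s| :=
    fun n s hs t ht => abs_integral_power_le (hforce n) (hzd n) hs ht
  have hD0 : 0 ≤ D * (K / α) := mul_nonneg ((norm_nonneg _).trans (hforce 0 0 h0)) hL0
  obtain ⟨σ, hσ, y, E, hyw, hE⟩ := exists_subseq_weak_limit hrefl hT.le (y := z)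
    (e := fun n t => ∫ x in (0 : ℝ)..t, (Λ n x - A (z n x)) (deriv (z n) x)) hzL hzR
    (M := D * (K / α)) (N := D * (K / α) * T)
    (fun n s hs t ht => by
      rw [integral_power_sub hT (hΛK n).continuousOn (hz n).mem hs ht]
      exact hpow n s hs t ht)
    (fun n t ht => by
      refine (hpow n 0 h0 t ht).trans ?_
      rw [sub_zero, abs_of_nonneg ht.1]
      exact mul_le_mul_of_nonneg_left ht.2 hD0)
  have hyL : ∀ s ∈ Icc 0 T, ∀ t ∈ Icc 0 T, ‖y t - y s‖ ≤ K / α * |t - s| :=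
    fun s hs t ht => norm_sub_le_of_weakTendsto (hyw t ht) (hyw s hs)
      fun n => hzL (σ n) s hs t ht
  have hinit' : Tendsto (fun n => z (σ n) 0) atTop (𝓝 y₀) := hinit.comp hσ.tendsto_atTop
  have hy0 : y 0 = y₀ := by
    rw [SeparatingDual.eq_iff_forall_dual_eq (R := ℝ)]
    exact fun ξ => tendsto_nhds_unique (hyw 0 h0 ξ) (weakTendsto_of_tendsto hinit' ξ)
  refine ⟨σ, hσ, y, ?_, hy0, hyw⟩
  refine (hmosco σ hσ).isEvolution hT hA hψ (fun n => hΨ (σ n))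
    (fun n v hv => le_trans (by positivity) (hcoerc (σ n) v hv)) hL0
    (fun n => (hΛK (σ n)).continuousOn) hℓK.continuousOn
    (fun t ht => (hΛ t ht).comp hσ.tendsto_atTop) (fun n => hC (σ n)) (fun n => hz (σ n))
    (fun n => hzd (σ n)) (fun n => hzR (σ n))
    ((memW1p_top_of_lipschitz hrefl hT hyL).mono le_top) hyL hyw (hy0 ▸ hinit')
    (fun n => hpow (σ n)) hE

end

end HardeningPlasticity

open HardeningPlasticity in
theorem theorem5p2 {Y : Type*} [NormedAddCommGroup Y] [NormedSpace ℝ Y] [CompleteSpace Y]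
    [TopologicalSpace.SeparableSpace Y]
    (hrefl : Function.Surjective (NormedSpace.inclusionInDoubleDual ℝ Y))
    (T : ℝ) (hT : 0 < T)
    -- the limiting problem
    (ψ : Y → EReal) (hψ : IsDissipation ψ) (hψ_nonneg : ∀ y, 0 ≤ ψ y)
    (A : Y →L[ℝ] StrongDual ℝ Y) (hA : ∀ x y, A x y = A y x)
    (hχ : ∀ y, y ≠ 0 → 0 < chi A y)
    (ℓ : ℝ → StrongDual ℝ Y) (y₀ : Y)
    -- the approximating problems, for `h > 0`
    (Yh : ℝ → Submodule ℝ Y) (hYh_closed : ∀ h, 0 < h → IsClosed (Yh h : Set Y))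
    (hYh_dense : Dense (⋃ h ∈ Ioi (0 : ℝ), (Yh h : Set Y)))
    (ψh : ℝ → Y → EReal) (hψh : ∀ h, 0 < h → IsDissipation (ψh h))
    (hmosco : ∀ u : ℕ → ℝ, (∀ n, 0 < u n) → Tendsto u atTop (𝓝 0) →
      MoscoTendsto (fun n => ψh (u n)) ψ)
    (α : ℝ) (hα : 0 < α)
    (hcoerc : ∀ h, 0 < h → ∀ y ∈ dom (ψh h) - dom (ψh h), α / 2 * ‖y‖ ^ 2 ≤ phi A y)
    (ℓh : ℝ → ℝ → StrongDual ℝ Y)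
    (hℓ : ∀ t ∈ Icc 0 T, Tendsto (fun h => ℓh h t) (𝓝[>] 0) (𝓝 (ℓ t)))
    (hℓ_lip : ∃ K : ℝ≥0, ∀ h, 0 < h → LipschitzOnWith K (ℓh h) (Icc 0 T))
    (y₀h : ℝ → Y) (hy₀h_mem : ∀ h, 0 < h → y₀h h ∈ Yh h)
    (hy₀h : Tendsto y₀h (𝓝[>] 0) (𝓝 y₀))
    -- the solutions of the approximating problems
    (yh : ℝ → ℝ → Y) (hyh : ∀ h, 0 < h → MemW1p T 1 (yh h))
    (hFh : ∀ h, 0 < h → FSub T (Yh h) (ψh h) A (ℓh h) (y₀h h) (yh h) = 0) :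
    ∃ y : ℝ → Y, WeakStarTendsto T yh y ∧ F T ψ A ℓ y₀ y = 0 ∧
      ∀ z : ℝ → Y, MemW1p T 1 z → F T ψ A ℓ y₀ z = 0 → EqOn z y (Icc 0 T) := by
  obtain ⟨K, hK⟩ := hℓ_lip
  have h0 : (0 : ℝ) ∈ Icc 0 T := ⟨le_rfl, hT.le⟩
  have hL0 : 0 ≤ K / α := by positivity
  have hℓK : LipschitzOnWith K ℓ (Icc 0 T) := by
    refine LipschitzOnWith.of_dist_le_mul fun s hs t ht => ?_
    refine le_of_tendsto ((hℓ s hs).dist (hℓ t ht)) ?_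
    filter_upwards [self_mem_nhdsWithin] with h hh
    exact (hK h hh).dist_le_mul s hs t ht
  have hev : ∀ h, 0 < h → IsEvolution T (ψh h) A (ℓh h) (yh h) ∧ yh h 0 = y₀h h := fun h hh =>
    isEvolution_of_FSub_eq_zero hT (hψh h hh) hχ (hK h hh).continuousOn (hyh h hh) (hFh h hh)
  have hder : ∀ h, 0 < h → ∀ᵐ t ∂volume.restrict (Ioo 0 T), ‖deriv (yh h) t‖ ≤ K / α :=
    fun h hh => (hev h hh).1.norm_deriv_le hT (hψh h hh) hα (hcoerc h hh) (hK h hh)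
  have hlip : ∀ h, 0 < h → ∀ s ∈ Icc 0 T, ∀ t ∈ Icc 0 T,
      ‖yh h t - yh h s‖ ≤ K / α * |t - s| :=
    fun h hh => (hev h hh).1.lipschitz hT (hψh h hh) hα (hcoerc h hh) (hK h hh)
  -- The sequence is arbitrary here: one choice produces the limit, and all the others are compared
  -- with it through uniqueness.
  have hsub : ∀ u : ℕ → ℝ, (∀ n, 0 < u n) → Tendsto u atTop (𝓝[>] 0) →
      ∃ σ : ℕ → ℕ, StrictMono σ ∧ ∃ y : ℝ → Y, IsEvolution T ψ A ℓ y ∧ y 0 = y₀ ∧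
        ∀ t ∈ Icc 0 T, WeakTendsto (fun n => yh (u (σ n)) t) (y t) := by
    intro u hu hu0
    refine exists_subseq_tendsto_evolution hrefl hT hψ hA (Ψ := fun n => ψh (u n))
      (fun n => hψh _ (hu n)) (fun σ hσ => ?_) hα (fun n => hcoerc _ (hu n))
      (Λ := fun n => ℓh (u n)) (fun t ht => (hℓ t ht).comp hu0) (fun n => hK _ (hu n)) hℓK
      (z := fun n => yh (u n)) (fun n => (hev _ (hu n)).1) ?_
    · exact hmosco (fun n => u (σ n)) (fun n => hu _)
        ((hu0.mono_right nhdsWithin_le_nhds).comp hσ.tendsto_atTop)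
    · simp only [(hev _ (hu _)).2]
      exact hy₀h.comp hu0
  have hseq : ∀ n : ℕ, 0 < 1 / ((n : ℝ) + 1) := fun n => by positivity
  have hseq0 : Tendsto (fun n : ℕ => 1 / ((n : ℝ) + 1)) atTop (𝓝 0) :=
    tendsto_one_div_add_atTop_nhds_zero_nat
  have hseq' : Tendsto (fun n : ℕ => 1 / ((n : ℝ) + 1)) atTop (𝓝[>] 0) :=
    tendsto_nhdsWithin_iff.2 ⟨hseq0, Eventually.of_forall hseq⟩
  have hcoerc₀ : ∀ y ∈ dom ψ - dom ψ, α / 2 * ‖y‖ ^ 2 ≤ phi A y :=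
    (hmosco _ hseq hseq0).coercive fun n => hcoerc _ (hseq n)
  obtain ⟨-, -, y, hy, hy0, -⟩ := hsub _ hseq hseq'
  have hpt : ∀ ξ : StrongDual ℝ Y, ∀ t ∈ Icc 0 T,
      Tendsto (fun h => ξ (yh h t)) (𝓝[>] 0) (𝓝 (ξ (y t))) := by
    intro ξ t ht
    refine tendsto_of_subseq_tendsto fun u hu => ?_
    -- A sequence tending to `0` within positive numbers is positive only eventually, hence the
    -- shift by `N`.
    obtain ⟨N, hN⟩ := eventually_atTop.1 (hu.eventually self_mem_nhdsWithin)
    obtain ⟨σ, -, z, hz, hz0, hzw⟩ := hsub (fun n => u (n + N)) (fun n => hN _ (Nat.le_add_left N n))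
      (hu.comp (tendsto_add_atTop_nat N))
    refine ⟨fun n => σ n + N, ?_⟩
    have heq : z t = y t := hz.eqOn hA hT hψ hα hcoerc₀ hℓK hy (hz0.trans hy0.symm) ht
    rw [← heq]
    exact hzw t ht ξ
  have hyd := hy.norm_deriv_le hT hψ hα hcoerc₀ hℓK
  refine ⟨y, ⟨fun h hh => (hyh h hh).memW1p_top hT (hder h hh), hy.mem.memW1p_top hT hyd,
    fun w hw => ⟨?_, ?_⟩⟩, ?_, ?_⟩
  · have hbd : ∀ᶠ h in 𝓝[>] (0 : ℝ), ‖y₀h h‖ ≤ ‖y₀‖ + 1 :=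
      hy₀h.norm.eventually (Iic_mem_nhds (lt_add_one _))
    refine tendsto_integral_apply_of_pointwise (L := ‖y₀‖ + 1 + K / α * T) ?_ ?_
      (fun ξ t ht => hpt ξ t (Ioo_subset_Icc_self ht)) hw
    · filter_upwards [self_mem_nhdsWithin] with h hh
      exact (((hyh h hh).continuousOn hT).mono Ioo_subset_Icc_self).aestronglyMeasurable
        measurableSet_Ioo
    · filter_upwards [self_mem_nhdsWithin, hbd] with h hh hb
      filter_upwards [ae_restrict_mem measurableSet_Ioo] with t ht
      refine (norm_le_of_lipschitz hT.le hL0 (hlip h hh) (Ioo_subset_Icc_self ht)).trans ?_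
      rw [(hev h hh).2]
      linarith
  · refine tendsto_integral_apply_deriv hT ?_ ?_ hy.mem hyd hpt hw
    · filter_upwards [self_mem_nhdsWithin] with h hh using hyh h hh
    · filter_upwards [self_mem_nhdsWithin] with h hh using hder h hh
  · exact (F_eq_zero_iff hT hψ hχ hℓK.continuousOn hy.mem y₀).2 ⟨hy, hy0⟩
  · intro z hz hFz
    obtain ⟨hz', hz0⟩ := (F_eq_zero_iff hT hψ hχ hℓK.continuousOn hz y₀).1 hFz
    exact hz'.eqOn hA hT hψ hα hcoerc₀ hℓK hy (hz0.trans hy0.symm)
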